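/- Let $r\ge 1$, let $p_1\ge p_2\ge\dots\ge p_r>0$ be integers with $p_1>1$, and let $r_1$ be the multiplicity of the largest part $p_1$. Let $\underline{t}=(t^{(a)}_j)_{1\le a\le r,\ j\ge 1}$ be time variables, and for $\underline m\in\mathbb Z^r$ put $|\underline m|_a=m_1+\dots+m_a$ and $|\underline m|=|\underline m|_r$; let $\underline e_a$ be the standard basis of $\mathbb Z^r$. Put $$e_+^{(a)}(\underline t,z)=\exp\Big(\sum_{j\ge1}z^jt^{(a)}_j\Big),\qquad e_-^{(a)}\Big(\frac{\partial}{\partial\underline t},z\Big)=\exp\Big(-\sum_{j\ge1}\frac{z^{-j}}{j}\frac{\partial}{\partial t^{(a)}_j}\Big).$$ A tau-function of charge $k\in\mathbb Z$ of the $\underline p$-reduced $r$-component KP hierarchy is a family of complex valued functions $\tau^{\underline m}(\underline t)$, $|\underline m|=k$, smooth in all the times, such that for all $\ell\ge0$ and all $\underline m',\underline m''\in\mathbb Z^r$ with $|\underline m'|=k+1$, $|\underline m''|=k-1$, $$\mathrm{Res}_z\sum_{a=1}^r(-1)^{|\underline m'+\underline m''|_{a-1}}z^{m'_a-m''_a+\ell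 p_a-2}\,e_+^{(a)}(\underline t'-\underline t'',z)\,e_-^{(a)}\Big(\frac{\partial}{\partial\underline t'}-\frac{\partial}{\partial\underline t''},z\Big)\tau^{\underline m'-\underline e_a}(\underline t')\,\tau^{\underline m''+\underline e_a}(\underline t'')=0,$$ meaning that one gets $0$ after applying any finite product of derivatives $\partial/\partial t'^{(b)}_j$ inside the residue and then setting $\underline t'=\underline t''$. Let such a tau-function be given, and let $|\underline m|=k$. Define the $r\times r$ matrices $P^\pm(\underline m,\underline t,z)$ by $$P^{\pm}_{ab}(\underline m,\underline t,\pm z)=(-1)^{|\underline e_a|_{b-1}}\frac{z^{\delta_{ab}-1}}{\tau^{\underline m}(\underline t)}\,e_-^{(b)}\Big(\pm\frac{\partial}{\partial\underline t},z\Big)\tau^{\underline m\pm\underline e_a\mp\underline e_b}(\underline t).$$ Let $Q^\pm(x)=Q^\pm(\underline m,x,\underline t,z)$ be obtained from $P^\pm(\underline m,\underline t,z)$ by setting $t^{(a)}_j=0$ for all $a>r_1$, $j\ge1$, and then replacing $t_1^{(a)}$ by $t_1^{(a)}+x$ for all $a\le r_1$; write $Q^\pm_{ab}=\delta_{ab}+\sum_{j\ge1}Q^\pm_{ab;j}z^{-j}$.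 Everything is considered where $\tau^{\underline m}$, at the times so reduced and translated, is defined and nonzero. There the $Q^\pm_{ab;j}$ are smooth functions of $x$; put $\partial=\partial_x$ and consider pseudodifferential operators in $\partial$ whose coefficients are smooth functions of $x$. The lower indices $\pm$ of an operator denote its differential part and the rest. Let $Q^+_{\mathbf1\mathbf1}(\partial)$ be the $r_1\times r_1$ matrix pseudodifferential operator with symbol $(Q^+_{ab})_{a,b\le r_1}$. It is invertible, and we put $$\mathcal L_a=Q^+_{\mathbf1\mathbf1}(\partial)\circ E_{aa}\partial\circ Q^+_{\mathbf1\mathbf1}(\partial)^{-1}\ (1\le a\le r_1),\qquad \widetilde{\mathcal L}=\sum_{a=1}^{r_1}\mathcal L_a^{p_1}.$$ Let $\widetilde W_{\mathbf1\mathbf2}=(\widetilde W_{ab})_{a\le r_1<b}$ and $\widetilde W_{\mathbf2\mathbf1}=(\widetilde W_{ab})_{b\le r_1<a}$ with $$\widetilde W_{ab}=\sum_{j=0}^{p_b-1}\sum_{i=0}^j\frac{(-x)^i}{i!}Q^+_{ab;j-i+1}\,\partial^j\quad(a\le r_1<b),\qquad \widetilde W_{ab}=-\sum_{j=0}^{p_a-1}\sum_{i=0}^j(-\partial)^j\circ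 Q^-_{ba;j-i+1}\frac{(-x)^i}{i!}\quad(b\le r_1<a),$$ and let $$\widetilde W_{\mathbf1\mathbf1}=\widetilde{\mathcal L}_+-\mathbb 1_{r_1}\partial^{p_1}+\Big(\widetilde W_{\mathbf1\mathbf2}\circ\Big(\sum_{a=r_1+1}^rE_{aa}\partial^{-p_a}\Big)\circ\widetilde W_{\mathbf2\mathbf1}\Big)_+.$$ Then $$\widetilde{\mathcal L}=\mathbb 1_{r_1}\partial^{p_1}+\widetilde W_{\mathbf1\mathbf1}-\widetilde W_{\mathbf1\mathbf2}\circ\Big(\sum_{a=r_1+1}^rE_{aa}\partial^{-p_a}\Big)\circ\widetilde W_{\mathbf2\mathbf1},$$ and $\widetilde W_{\mathbf1\mathbf1},\widetilde W_{\mathbf1\mathbf2},\widetilde W_{\mathbf2\mathbf1}$ are matrices of differential operators: the entries of $\widetilde W_{\mathbf1\mathbf1}$ have order at most $p_1-1$, and $\widetilde W_{ab}$, for $a\le r_1<b$ or $b\le r_1<a$, has order at most $\min\{p_a,p_b\}-1$. -/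

import Mathlib

/-- Underlying additive group of `R((∂⁻¹))`: families of coefficients indexed by the power of `∂`
which vanish for all sufficiently large powers. -/
def PDO.carrier (R : Type*) [CommRing R] : AddSubgroup (ℤ → R) where
  carrier := {f | ∃ N : ℤ, ∀ n, N < n → f n = 0}
  zero_mem' := ⟨0, fun _ _ => rfl⟩
  add_mem' := by
    rintro f g ⟨N, hN⟩ ⟨M, hM⟩
    exact ⟨max N M, fun n hn => by
      simp [hN n (lt_of_le_of_lt (le_max_left _ _) hn), hM n (lt_of_le_of_lt (le_max_right _ _) hn)]⟩
  neg_mem' := by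
    rintro f ⟨N, hN⟩
    exact ⟨N, fun n hn => by simp [hN n hn]⟩

/-- The scalar pseudodifferential operators `∑_{n ≤ N} aₙ ∂ⁿ` over the differential ring `R`. -/
def PDO (R : Type*) [CommRing R] : Type _ := PDO.carrier R

namespace PDO

section Basic

variable {R : Type*} [CommRing R]

instance : AddCommGroup (PDO R) := inferInstanceAs (AddCommGroup (PDO.carrier R))

/-- The coefficient of `∂ⁿ`. -/
def coeff (a : PDO R) (n : ℤ) : R := a.1 n

@[ext]
theorem ext {a b : PDO R} (h : ∀ n, a.coeff n = b.coeff n) : a = b :=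
  Subtype.ext (funext h)

@[simp] theorem coeff_add (a b : PDO R) (n : ℤ) : (a + b).coeff n = a.coeff n + b.coeff n := rfl
@[simp] theorem coeff_zero (n : ℤ) : (0 : PDO R).coeff n = 0 := rfl
@[simp] theorem coeff_neg (a : PDO R) (n : ℤ) : (-a).coeff n = -a.coeff n := rfl

/-- `a` has order at most `N`. -/
def OrderLE (a : PDO R) (N : ℤ) : Prop := ∀ n, N < n → a.coeff n = 0

theorem exists_orderLE (a : PDO R) : ∃ N, a.OrderLE N := a.2

theorem OrderLE.mono {a : PDO R} {N M : ℤ} (h : a.OrderLE N) (hNM : N ≤ M) : a.OrderLE M :=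
  fun n hn => h n (lt_of_le_of_lt hNM hn)

/-- `a` is a differential operator: only nonnegative powers of `∂` occur. -/
def IsDifferential (a : PDO R) : Prop := ∀ n, n < 0 → a.coeff n = 0

/-- The operator `f ∂ⁿ`. -/
def monomial (n : ℤ) (f : R) : PDO R :=
  ⟨fun k => if k = n then f else 0, n, fun _ hk => if_neg hk.ne'⟩

@[simp] theorem coeff_monomial (n : ℤ) (f : R) (k : ℤ) :
    (monomial n f).coeff k = if k = n then f else 0 := rfl

theorem OrderLE.add {a b : PDO R} {A : ℤ} (ha : a.OrderLE A) (hb : b.OrderLE A) :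
    (a + b).OrderLE A := fun n hn => by simp [ha n hn, hb n hn]

theorem ext_of_orderLE {a b : PDO R} {A : ℤ} (ha : a.OrderLE A) (hb : b.OrderLE A)
    (h : ∀ N : ℕ, a.coeff (A - N) = b.coeff (A - N)) : a = b := by
  ext n
  by_cases hn : A < n
  · rw [ha n hn, hb n hn]
  · have := h (A - n).toNat
    rwa [show A - ((A - n).toNat : ℤ) = n by omega] at this

theorem exists_common (a b c : PDO R) : ∃ N, a.OrderLE N ∧ b.OrderLE N ∧ c.OrderLE N := by
  obtain ⟨A, hA⟩ := a.exists_orderLE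
  obtain ⟨B, hB⟩ := b.exists_orderLE
  obtain ⟨C, hC⟩ := c.exists_orderLE
  exact ⟨max A (max B C), hA.mono (by simp), hB.mono (by simp), hC.mono (by simp)⟩

instance : One (PDO R) := ⟨monomial 0 1⟩

theorem coeff_one (n : ℤ) : (1 : PDO R).coeff n = if n = 0 then 1 else 0 := rfl

/-- The differential part `a₊`. -/
def plus (a : PDO R) : PDO R :=
  ⟨fun n => if 0 ≤ n then a.coeff n else 0, by
    obtain ⟨N, hN⟩ := a.exists_orderLE
    exact ⟨N, fun n hn => by simp [hN n hn]⟩⟩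

/-- The operator `∑_{n ≥ 0} fₙ ∂⁻ⁿ` with symbol `∑_{n ≥ 0} fₙ z⁻ⁿ`. -/
def ofSeries (f : ℕ → R) : PDO R :=
  ⟨fun n => if n ≤ 0 then f (-n).toNat else 0, 0, fun _ hn => if_neg (not_le.2 hn)⟩

end Basic

section Mul

variable {R : Type*} [CommRing R] [Differential R]

/-- The coefficient of `∂ⁿ` in `a ∘ b`, from the rule
`∂ⁱ ∘ f = ∑_{k ≥ 0} binom(i, k) f⁽ᵏ⁾ ∂ⁱ⁻ᵏ` for `i ∈ ℤ`; all but finitely many terms vanish. -/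
noncomputable def mulCoeff (a b : PDO R) (n : ℤ) : R :=
  ∑ᶠ q : ℤ × ℕ, Ring.choose q.1 q.2 •
    (a.coeff q.1 * (Differential.deriv)^[q.2] (b.coeff (n - q.1 + q.2)))

theorem iter_add (k : ℕ) (f g : R) :
    (Differential.deriv)^[k] (f + g)
      = (Differential.deriv)^[k] f + (Differential.deriv)^[k] g :=
  iterate_map_add _ _ _ _

theorem iter_zero (k : ℕ) : (Differential.deriv)^[k] (0 : R) = 0 :=
  iterate_map_zero _ _

theorem iter_sum {ι : Type*} (s : Finset ι) (f : ι → R) (k : ℕ) :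
    (Differential.deriv)^[k] (∑ i ∈ s, f i) = ∑ i ∈ s, (Differential.deriv)^[k] (f i) := by
  classical
  induction s using Finset.induction_on with
  | empty => simp
  | insert a s ha ih => rw [Finset.sum_insert ha, Finset.sum_insert ha, iter_add, ih]

theorem iter_smul (k : ℕ) (c : ℤ) (f : R) :
    (Differential.deriv)^[k] (c • f) = c • (Differential.deriv)^[k] f := by
  induction k generalizing f with
  | zero => rfl
  | succ k ih => rw [Function.iterate_succ_apply, map_zsmul, ih, Function.iterate_succ_apply]

theorem iter_mul (k : ℕ) (f g : R) :
    (Differential.deriv)^[k] (f * g) = ∑ q ∈ Finset.HasAntidiagonal.antidiagonal k,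
      k.choose q.1 • ((Differential.deriv)^[q.1] f * (Differential.deriv)^[q.2] g) := by
  induction k with
  | zero => simp
  | succ k ih =>
    rw [Function.iterate_succ_apply', ih, map_sum]
    rw [Finset.sum_antidiagonal_choose_succ_nsmul
      (fun i j => (Differential.deriv)^[i] f * (Differential.deriv)^[j] g) k]
    rw [← Finset.sum_add_distrib]
    refine Finset.sum_congr rfl fun q hq => ?_
    rw [k.choose_symm_of_eq_add (Finset.HasAntidiagonal.mem_antidiagonal.1 hq).symm, map_nsmul,
      Derivation.leibniz, ← smul_add]
    simp only [smul_eq_mul, Function.iterate_succ_apply']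
    congr 1
    ring

theorem mulCoeff_eq {a b : PDO R} {A B : ℤ} (ha : a.OrderLE A) (hb : b.OrderLE B) (N : ℕ) :
    mulCoeff a b (A + B - N) =
      ∑ q ∈ Finset.HasAntidiagonal.antidiagonal N, ∑ s ∈ Finset.HasAntidiagonal.antidiagonal q.2,
        Ring.choose (A - q.1) s.2 •
          (a.coeff (A - q.1) * (Differential.deriv)^[s.2] (b.coeff (B - s.1))) := by
  rw [Finset.sum_sigma']
  unfold mulCoeff
  rw [← finsum_mem_univ, finsum_mem_eq_sum_of_inter_support_eq
    (t := ((Finset.HasAntidiagonal.antidiagonal N).sigma fun q => Finset.HasAntidiagonal.antidiagonal q.2).image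
      fun w => ((A - w.1.1 : ℤ), w.2.2))]
  · rw [Finset.sum_image]
    · refine Finset.sum_congr rfl fun w hw => ?_
      simp only [Finset.mem_sigma, Finset.HasAntidiagonal.mem_antidiagonal] at hw
      congr 4
      omega
    · rintro ⟨⟨u, w⟩, v, k⟩ h ⟨⟨u', w'⟩, v', k'⟩ h' he
      simp only [Finset.coe_sigma, Set.mem_sigma_iff, Finset.mem_coe,
        Finset.HasAntidiagonal.mem_antidiagonal, Prod.mk.injEq] at h h' he
      obtain ⟨h1, h2⟩ := h
      obtain ⟨h3, h4⟩ := h'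
      obtain ⟨h5, h6⟩ := he
      have e1 : u = u' := by omega
      have e2 : w = w' := by omega
      have e3 : v = v' := by omega
      subst e1 e2 e3 h6
      rfl
  · ext ⟨i, k⟩
    simp only [Set.univ_inter, Function.mem_support, Set.mem_inter_iff,
      Finset.coe_image, Set.mem_image, Finset.mem_coe, Finset.mem_sigma, Finset.HasAntidiagonal.mem_antidiagonal]
    constructor
    · intro h
      refine ⟨?_, h⟩
      have h1 : i ≤ A := by
        by_contra hc
        exact h (by rw [ha i (by omega)]; simp)
      have h2 : A + B - N - i + k ≤ B := by
        by_contra hc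
        exact h (by rw [hb _ (by omega), iter_zero]; simp)
      refine ⟨⟨((A - i).toNat, N - (A - i).toNat), (N - (A - i).toNat - k, k)⟩, ⟨?_, ?_⟩, ?_⟩
      · simp; omega
      · simp; omega
      · simp; omega
    · exact fun h => h.2

theorem mulCoeff_eq_zero {a b : PDO R} {A B : ℤ} (ha : a.OrderLE A) (hb : b.OrderLE B) (n : ℤ)
    (hn : A + B < n) : mulCoeff a b n = 0 := by
  unfold mulCoeff
  refine finsum_eq_zero_of_forall_eq_zero ?_
  rintro ⟨i, k⟩
  by_cases h : A < i
  · simp [ha i h]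
  · rw [hb _ (by simp only; omega), iter_zero]; simp

noncomputable instance : Mul (PDO R) :=
  ⟨fun a b => ⟨mulCoeff a b, by
    obtain ⟨A, hA⟩ := a.exists_orderLE
    obtain ⟨B, hB⟩ := b.exists_orderLE
    exact ⟨A + B, fun n hn => mulCoeff_eq_zero hA hB n hn⟩⟩⟩

theorem coeff_mul (a b : PDO R) (n : ℤ) : (a * b).coeff n = mulCoeff a b n := rfl

theorem OrderLE.mul {a b : PDO R} {A B : ℤ} (ha : a.OrderLE A) (hb : b.OrderLE B) :
    (a * b).OrderLE (A + B) := fun n hn => mulCoeff_eq_zero ha hb n hn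

theorem coeff_mul_of_le {a b : PDO R} {A B : ℤ} (ha : a.OrderLE A) (hb : b.OrderLE B) (N : ℕ) :
    (a * b).coeff (A + B - N) =
      ∑ q ∈ Finset.HasAntidiagonal.antidiagonal N, ∑ s ∈ Finset.HasAntidiagonal.antidiagonal q.2,
        Ring.choose (A - q.1) s.2 •
          (a.coeff (A - q.1) * (Differential.deriv)^[s.2] (b.coeff (B - s.1))) :=
  mulCoeff_eq ha hb N

theorem mul_add' (a b c : PDO R) : a * (b + c) = a * b + a * c := by
  obtain ⟨N, hA, hB, hC⟩ := exists_common a b c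
  refine ext_of_orderLE (hA.mul (hB.add hC)) ((hA.mul hB).add (hA.mul hC)) fun n => ?_
  rw [coeff_add, coeff_mul_of_le hA (hB.add hC), coeff_mul_of_le hA hB, coeff_mul_of_le hA hC]
  simp only [coeff_add, iter_add, mul_add, smul_add, Finset.sum_add_distrib]

theorem add_mul' (a b c : PDO R) : (a + b) * c = a * c + b * c := by
  obtain ⟨N, hA, hB, hC⟩ := exists_common a b c
  refine ext_of_orderLE ((hA.add hB).mul hC) ((hA.mul hC).add (hB.mul hC)) fun n => ?_
  rw [coeff_add, coeff_mul_of_le (hA.add hB) hC, coeff_mul_of_le hA hC, coeff_mul_of_le hB hC]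
  simp only [coeff_add, add_mul, smul_add, Finset.sum_add_distrib]

theorem choose_identity (α β : ℤ) (s L : ℕ) :
    ∑ q ∈ Finset.HasAntidiagonal.antidiagonal L,
        Ring.choose α (s + q.1) * ((s + q.1).choose s : ℤ) * Ring.choose β q.2
      = Ring.choose α s * Ring.choose (α + β - s) L := by
  rw [show α + β - (s : ℤ) = (α - s) + β by ring, Ring.add_choose_eq L (Commute.all _ _),
    Finset.mul_sum]
  refine Finset.sum_congr rfl fun q _ => ?_
  have h := Ring.choose_smul_choose α (n := s + q.1) (k := s) (by omega)
  simp only [nsmul_eq_mul, Nat.add_sub_cancel_left] at h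
  rw [← mul_assoc, ← h]
  ring

theorem mul_assoc' (a b c : PDO R) : a * b * c = a * (b * c) := by
  obtain ⟨A, hA⟩ := a.exists_orderLE
  obtain ⟨B, hB⟩ := b.exists_orderLE
  obtain ⟨C, hC⟩ := c.exists_orderLE
  refine ext_of_orderLE (A := A + B + C) ((hA.mul hB).mul hC)
    ((hA.mul (hB.mul hC)).mono (by omega)) fun N => ?_
  rw [coeff_mul_of_le (hA.mul hB) hC, add_assoc, coeff_mul_of_le hA (hB.mul hC)]
  simp only [coeff_mul_of_le hA hB, coeff_mul_of_le hB hC, iter_sum, iter_smul, iter_mul,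
    Finset.smul_sum, Finset.mul_sum, Finset.sum_mul, Finset.sum_sigma']
  trans ∑ x ∈ (Finset.HasAntidiagonal.antidiagonal N).sigma fun a =>
      (Finset.HasAntidiagonal.antidiagonal a.2).sigma fun _ =>
        (Finset.HasAntidiagonal.antidiagonal a.1).sigma fun a =>
          Finset.HasAntidiagonal.antidiagonal a.2,
      ∑ z ∈ Finset.HasAntidiagonal.antidiagonal x.2.1.2,
        (Ring.choose (A - x.2.2.1.1) (x.2.2.2.2 + z.1) *
          ((x.2.2.2.2 + z.1).choose x.2.2.2.2 : ℤ) * Ring.choose (B - x.2.2.2.1) z.2) •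
        (a.coeff (A - x.2.2.1.1) *
          (Differential.deriv)^[x.2.2.2.2] (b.coeff (B - x.2.2.2.1)) *
          (Differential.deriv)^[z.1 + z.2] (c.coeff (C - x.2.1.1)))
  · refine Finset.sum_congr rfl fun x hx => ?_
    simp only [Finset.mem_sigma, Finset.HasAntidiagonal.mem_antidiagonal] at hx
    obtain ⟨-, -, h3, h4⟩ := hx
    have hu : A + B - (x.1.1 : ℤ) = (A - x.2.2.1.1) + (B - x.2.2.2.1) - x.2.2.2.2 := by omega
    trans ∑ z ∈ Finset.HasAntidiagonal.antidiagonal x.2.1.2,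
        (Ring.choose (A - x.2.2.1.1) (x.2.2.2.2 + z.1) *
          ((x.2.2.2.2 + z.1).choose x.2.2.2.2 : ℤ) * Ring.choose (B - x.2.2.2.1) z.2) •
        (a.coeff (A - x.2.2.1.1) *
          (Differential.deriv)^[x.2.2.2.2] (b.coeff (B - x.2.2.2.1)) *
          (Differential.deriv)^[x.2.1.2] (c.coeff (C - x.2.1.1)))
    · rw [← Finset.sum_smul, choose_identity, ← hu, mul_smul, smul_mul_assoc, smul_comm]
    · refine Finset.sum_congr rfl fun z hz => ?_
      rw [Finset.HasAntidiagonal.mem_antidiagonal.1 hz]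
  · rw [Finset.sum_sigma']
    refine Finset.sum_nbij'
      (fun x => ⟨(x.1.2.2.1.1, N - x.1.2.2.1.1),
        (x.1.2.2.2.1 + x.1.2.1.1 + x.2.2, x.1.2.2.2.2 + x.2.1),
        ⟨(x.1.2.2.2.1, x.1.2.1.1 + x.2.2), (x.1.2.1.1, x.2.2)⟩, (x.1.2.2.2.2, x.2.1)⟩)
      (fun y => ⟨⟨(y.1.1 + y.2.2.1.1.1 + y.2.2.2.1,
          N - (y.1.1 + y.2.2.1.1.1 + y.2.2.2.1)),
        (y.2.2.1.2.1, y.2.2.2.2 + y.2.2.1.2.2),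
        (y.1.1, y.2.2.1.1.1 + y.2.2.2.1), (y.2.2.1.1.1, y.2.2.2.1)⟩,
        (y.2.2.2.2, y.2.2.1.2.2)⟩) ?_ ?_ ?_ ?_ ?_
    · rintro ⟨⟨⟨u, w⟩, ⟨v, L⟩, ⟨i, y⟩, ⟨j, s⟩⟩, ⟨q, l⟩⟩ h
      simp only [Finset.mem_sigma, Finset.HasAntidiagonal.mem_antidiagonal] at h ⊢
      refine ⟨?_, ?_, ⟨?_, ?_⟩, ?_⟩ <;> (try dsimp only at *) <;> omega
    · rintro ⟨⟨i, w⟩, ⟨y, K⟩, ⟨⟨j, y'⟩, ⟨v, l⟩⟩, ⟨s, q⟩⟩ h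
      simp only [Finset.mem_sigma, Finset.HasAntidiagonal.mem_antidiagonal] at h ⊢
      refine ⟨⟨?_, ?_, ?_, ?_⟩, ?_⟩ <;> (try dsimp only at *) <;> omega
    · rintro ⟨⟨⟨u, w⟩, ⟨v, L⟩, ⟨i, y⟩, ⟨j, s⟩⟩, ⟨q, l⟩⟩ h
      simp only [Finset.mem_sigma, Finset.HasAntidiagonal.mem_antidiagonal] at h ⊢
      obtain ⟨⟨h1, h2, h3, h4⟩, h5⟩ := h
      subst h5 h4 h3 h2
      simp only [Sigma.mk.injEq, Prod.mk.injEq, heq_eq_eq, and_true]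
      omega
    · rintro ⟨⟨i, w⟩, ⟨y, K⟩, ⟨⟨j, y'⟩, ⟨v, l⟩⟩, ⟨s, q⟩⟩ h
      simp only [Finset.mem_sigma, Finset.HasAntidiagonal.mem_antidiagonal] at h ⊢
      obtain ⟨h1, h2, ⟨h3, h4⟩, h5⟩ := h
      subst h5 h4 h3 h2
      simp only [Sigma.mk.injEq, Prod.mk.injEq, heq_eq_eq, and_true, true_and]
      omega
    · rintro ⟨⟨⟨u, w⟩, ⟨v, L⟩, ⟨i, y⟩, ⟨j, s⟩⟩, ⟨q, l⟩⟩ h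
      simp only [zsmul_eq_mul, nsmul_eq_mul, Function.iterate_add_apply]
      push_cast
      ring

theorem iter_one (k : ℕ) : (Differential.deriv)^[k] (1 : R) = if k = 0 then 1 else 0 := by
  cases k with
  | zero => rfl
  | succ k => rw [Function.iterate_succ_apply, Derivation.map_one_eq_zero, iter_zero]; simp

theorem one_mul' (a : PDO R) : 1 * a = a := by
  ext n
  rw [coeff_mul, mulCoeff, finsum_eq_single _ ((0 : ℤ), 0)]
  · simp [coeff_one]
  · rintro ⟨i, k⟩ h
    by_cases hi : i = 0
    · subst hi
      have hk : 0 < k := Nat.pos_of_ne_zero fun hk => h (by rw [hk])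
      simp [Ring.choose_zero_pos ℤ hk]
    · simp [coeff_one, hi]

theorem mul_one' (a : PDO R) : a * 1 = a := by
  ext n
  rw [coeff_mul, mulCoeff, finsum_eq_single _ (n, 0)]
  · simp [coeff_one]
  · rintro ⟨i, k⟩ h
    by_cases hk : n - i + k = 0
    · have hk0 : k ≠ 0 := by
        rintro rfl
        exact h (by rw [show i = n by simpa [sub_eq_zero, eq_comm] using hk])
      simp [coeff_one, hk, iter_one, hk0]
    · simp [coeff_one, hk]

noncomputable instance : Ring (PDO R) where
  __ := (inferInstance : AddCommGroup (PDO R))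
  left_distrib := mul_add'
  right_distrib := add_mul'
  zero_mul a := by simpa using add_mul' 0 0 a
  mul_zero a := by simpa using mul_add' a 0 0
  mul_assoc := mul_assoc'
  one_mul := one_mul'
  mul_one := mul_one'

end Mul

end PDO

open scoped ContDiff Topology

/-! ### Smooth functions of the space variable -/

section SmoothFun

variable {𝕜 : Type*} [RCLike 𝕜] [NormedAlgebra 𝕜 ℂ]

/-- The `ℂ`-algebra of smooth complex valued functions on an open subset `U` of the line `𝕜`. -/
def smoothFun (U : TopologicalSpace.Opens 𝕜) : Subalgebra ℂ (U → ℂ) where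
  carrier := {f | ∃ g : 𝕜 → ℂ, ContDiffOn 𝕜 ∞ g U ∧ ∀ u : U, f u = g u}
  mul_mem' := by
    rintro f₁ f₂ ⟨g₁, h₁, e₁⟩ ⟨g₂, h₂, e₂⟩
    exact ⟨fun x => g₁ x * g₂ x, h₁.mul h₂, fun u => by simp [e₁, e₂]⟩
  add_mem' := by
    rintro f₁ f₂ ⟨g₁, h₁, e₁⟩ ⟨g₂, h₂, e₂⟩
    exact ⟨fun x => g₁ x + g₂ x, h₁.add h₂, fun u => by simp [e₁, e₂]⟩
  algebraMap_mem' c := ⟨fun _ => c, contDiffOn_const, fun _ => rfl⟩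

namespace smoothFun

variable {U : TopologicalSpace.Opens 𝕜}

/-- Extension of `f : U → ℂ` by zero. -/
noncomputable def zeroExt (f : U → ℂ) : 𝕜 → ℂ := Function.extend Subtype.val f 0

theorem zeroExt_apply (f : U → ℂ) (u : U) : zeroExt f u = f u :=
  Subtype.val_injective.extend_apply f 0 u

theorem contDiffOn_zeroExt (f : smoothFun U) : ContDiffOn 𝕜 ∞ (zeroExt f.1) U := by
  obtain ⟨f, g, hg, e⟩ := f
  exact hg.congr fun x hx => (zeroExt_apply f ⟨x, hx⟩).trans (e ⟨x, hx⟩)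

theorem differentiableAt_zeroExt (f : smoothFun U) (u : U) :
    DifferentiableAt 𝕜 (zeroExt f.1) u :=
  ((contDiffOn_zeroExt f).contDiffAt (U.isOpen.mem_nhds u.2)).differentiableAt (by simp)

theorem zeroExt_eventuallyEq (f : U → ℂ) (g : 𝕜 → ℂ) (e : ∀ u : U, f u = g u) (u : U) :
    zeroExt f =ᶠ[𝓝 (u : 𝕜)] g := by
  filter_upwards [U.isOpen.mem_nhds u.2] with x hx
  exact (zeroExt_apply f ⟨x, hx⟩).trans (e ⟨x, hx⟩)

/-- The derivation `∂ = d/dx`. -/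
noncomputable instance : Differential (smoothFun U) where
  deriv := Derivation.mk'
    { toFun := fun f => ⟨fun u => deriv (zeroExt f.1) (u : 𝕜), deriv (zeroExt f.1),
        (contDiffOn_zeroExt f).deriv_of_isOpen U.isOpen (by simp), fun _ => rfl⟩
      map_add' := fun f g => by
        refine Subtype.ext (funext fun u => ?_)
        change deriv (zeroExt (f.1 + g.1)) (u : 𝕜)
          = deriv (zeroExt f.1) (u : 𝕜) + deriv (zeroExt g.1) (u : 𝕜)
        rw [← deriv_add (differentiableAt_zeroExt f u) (differentiableAt_zeroExt g u)]
        refine (zeroExt_eventuallyEq _ _ (fun v => ?_) u).deriv_eq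
        simp [zeroExt_apply]
      map_smul' := fun c f => by
        refine Subtype.ext (funext fun u => ?_)
        change deriv (zeroExt (c • f.1)) (u : 𝕜) = c • deriv (zeroExt f.1) (u : 𝕜)
        rw [zsmul_eq_mul (deriv (zeroExt f.1) (u : 𝕜)) c,
          ← deriv_const_mul (c : ℂ) (differentiableAt_zeroExt f u)]
        refine (zeroExt_eventuallyEq _ _ (fun v => ?_) u).deriv_eq
        simp [zeroExt_apply] }
    (fun f g => by
      refine Subtype.ext (funext fun u => ?_)
      change deriv (zeroExt (f.1 * g.1)) (u : 𝕜)
        = f.1 u * deriv (zeroExt g.1) (u : 𝕜) + g.1 u * deriv (zeroExt f.1) (u : 𝕜)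
      have h : deriv (zeroExt (f.1 * g.1)) (u : 𝕜) = deriv (zeroExt f.1 * zeroExt g.1) (u : 𝕜) := by
        refine (zeroExt_eventuallyEq _ _ (fun v => ?_) u).deriv_eq
        simp [zeroExt_apply]
      rw [h, deriv_mul (differentiableAt_zeroExt f u) (differentiableAt_zeroExt g u),
        zeroExt_apply, zeroExt_apply]
      ring)

/-- The coordinate function `x`. -/
noncomputable def X (U : TopologicalSpace.Opens 𝕜) : smoothFun U :=
  ⟨fun u => algebraMap 𝕜 ℂ u, fun x => algebraMap 𝕜 ℂ x,
    (algebraMapCLM 𝕜 ℂ).contDiff.contDiffOn, fun _ => rfl⟩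

end smoothFun

end SmoothFun

/-! ### Functions of the times -/

/-- The space of times `t = (t_j^{(a)})`, with `a ∈ {1, …, r}` and `j ∈ ℤ_{>0}`. -/
abbrev Times (𝕜 : Type*) (r : ℕ) : Type _ := Fin r × ℕ+ → 𝕜

section Times

variable {𝕜 : Type*} [RCLike 𝕜] [NormedAlgebra 𝕜 ℂ] {r : ℕ}

/-- Change of the finitely many times in `S` by the increments `s`. -/
def Times.shift (t : Times 𝕜 r) (S : Finset (Fin r × ℕ+)) (s : S → 𝕜) : Times 𝕜 r :=
  fun i => t i + if h : i ∈ S then s ⟨i, h⟩ else 0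

/-- `D` is open in each finite set of times, the other times being fixed. -/
def Times.FinOpen (D : Set (Times 𝕜 r)) : Prop :=
  ∀ t ∈ D, ∀ S : Finset (Fin r × ℕ+), ∀ᶠ s : S → 𝕜 in 𝓝 0, t.shift S s ∈ D

/-- `f` is smooth on `D` in all the time variables: jointly smooth in each finite set of times,
the other times being fixed. -/
def SmoothInTimes (D : Set (Times 𝕜 r)) (f : Times 𝕜 r → ℂ) : Prop :=
  ∀ t ∈ D, ∀ S : Finset (Fin r × ℕ+), ContDiffAt 𝕜 ∞ (fun s : S → 𝕜 => f (t.shift S s)) 0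

/-- The partial derivative `∂f/∂t_j^{(a)}`, where `i = (a, j)`. -/
noncomputable def timeDeriv (i : Fin r × ℕ+) (f : Times 𝕜 r → ℂ) : Times 𝕜 r → ℂ :=
  fun t => deriv (fun h : 𝕜 => f (t + Pi.single i h)) 0

/-- The coefficient of `z⁻ⁿ` in `e_-^{(a)}(ε ∂/∂t, z) f = exp(-∑_{j ≥ 1} (z^{-j}/j) ε ∂/∂t_j^{(a)}) f`.
It is the sum over all `(j₁, …, jₗ)` with `j₁ + ⋯ + jₗ = n` of
`(1/l!) ∏ᵢ (-(ε/jᵢ) ∂/∂t_{jᵢ}^{(a)}) f`. -/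
noncomputable def eMinus (ε : ℤˣ) (a : Fin r) (n : ℕ) (f : Times 𝕜 r → ℂ) : Times 𝕜 r → ℂ :=
  fun t => ∑ c : Composition n, (1 / (c.length.factorial : ℂ)) *
    c.blocks.foldr
      (fun (j : ℕ) g => fun t' => -(((ε : ℤ) : ℂ) / (j : ℂ)) * timeDeriv (a, j.toPNat') g t') f t

theorem SmoothInTimes.timeDeriv {D : Set (Times 𝕜 r)} {f : Times 𝕜 r → ℂ}
    (hf : SmoothInTimes D f) (i : Fin r × ℕ+) : SmoothInTimes D (timeDeriv i f) := by
  classical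
  intro t ht S
  have hF := hf t ht (insert i S)
  set F : (↥(insert i S : Finset (Fin r × ℕ+)) → 𝕜) → ℂ := fun s => f (t.shift (insert i S) s)
  let E : (S → 𝕜) →L[𝕜] (↥(insert i S : Finset (Fin r × ℕ+)) → 𝕜) :=
    ContinuousLinearMap.pi fun q =>
      if h : (q : Fin r × ℕ+) ∈ S then ContinuousLinearMap.proj ⟨q, h⟩ else 0
  let v : (↥(insert i S : Finset (Fin r × ℕ+)) → 𝕜) := Pi.single ⟨i, Finset.mem_insert_self i S⟩ 1
  have hE : ∀ s q, E s q = if h : (q : Fin r × ℕ+) ∈ S then s ⟨q, h⟩ else 0 := by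
    intro s q
    by_cases h : (q : Fin r × ℕ+) ∈ S <;> simp [E, h]
  have key : ∀ (s : S → 𝕜) (h : 𝕜), f (t.shift S s + Pi.single i h) = F (E s + h • v) := by
    intro s h
    refine congrArg f (funext fun q => ?_)
    by_cases hq : q = i
    · subst hq
      simp [Times.shift, hE, v, add_assoc]
    · by_cases hS : q ∈ S <;> simp [Times.shift, hE, v, hq, hS, Subtype.ext_iff]
  have hE0 : E 0 = 0 := map_zero E
  have hd : ∀ᶠ s in 𝓝 (0 : S → 𝕜), DifferentiableAt 𝕜 F (E s) := by
    have h1 : ∀ᶠ y in 𝓝 (E 0), ContDiffAt 𝕜 1 F y := by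
      rw [hE0]
      exact (hF.of_le (by simp)).eventually (by simp)
    filter_upwards [E.continuous.continuousAt.eventually h1] with s hs
    exact hs.differentiableAt (by simp)
  have hsm : ContDiffAt 𝕜 ∞ (fun s => fderiv 𝕜 F (E s) v) 0 := by
    have h2 : ContDiffAt 𝕜 ∞ (fderiv 𝕜 F) (E 0) := by
      rw [hE0]; exact hF.fderiv_right (by simp)
    exact (h2.comp (0 : S → 𝕜) E.contDiff.contDiffAt).clm_apply contDiffAt_const
  refine hsm.congr_of_eventuallyEq ?_
  filter_upwards [hd] with s hs
  change deriv (fun h : 𝕜 => f (t.shift S s + Pi.single i h)) 0 = _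
  simp only [key]
  have hl : HasDerivAt (fun h : 𝕜 => E s + h • v) v 0 := by
    simpa using ((hasDerivAt_id (0 : 𝕜)).smul_const v).const_add (E s)
  have hs' : HasFDerivAt F (fderiv 𝕜 F (E s)) (E s + (0 : 𝕜) • v) := by
    simpa using hs.hasFDerivAt
  exact (hs'.comp_hasDerivAt (0 : 𝕜) hl).deriv

theorem SmoothInTimes.eMinus {D : Set (Times 𝕜 r)} {f : Times 𝕜 r → ℂ}
    (hf : SmoothInTimes D f) (ε : ℤˣ) (a : Fin r) (n : ℕ) :
    SmoothInTimes D (eMinus ε a n f) := by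
  intro t ht S
  refine ContDiffAt.sum fun c _ => contDiffAt_const.mul ?_
  have h : ∀ l : List ℕ, SmoothInTimes D (l.foldr
      (fun (j : ℕ) g => fun t' => -(((ε : ℤ) : ℂ) / (j : ℂ)) * _root_.timeDeriv (a, j.toPNat') g t') f) := by
    intro l
    induction l with
    | nil => exact hf
    | cons j l ih => exact fun t ht S => contDiffAt_const.mul ((ih.timeDeriv (a, j.toPNat')) t ht S)
  exact h _ t ht S

end Times

/-! ### Tau-functions -/

/-- A tau-function of charge `k`: functions `τ^m` of the times, for `m ∈ ℤʳ` with `|m| = k`,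
smooth in all the times. (The values `toFun m` with `|m| ≠ k` are never used.) -/
structure TauFunction (𝕜 : Type*) [RCLike 𝕜] [NormedAlgebra 𝕜 ℂ] (r : ℕ) (k : ℤ) where
  /-- The common domain of definition of the functions. -/
  domain : Set (Times 𝕜 r)
  finOpen : Times.FinOpen domain
  /-- The functions `τ^m`. -/
  toFun : (Fin r → ℤ) → Times 𝕜 r → ℂ
  smooth : ∀ m : Fin r → ℤ, ∑ a, m a = k → SmoothInTimes domain (toFun m)

namespace TauFunction

variable {𝕜 : Type*} [RCLike 𝕜] [NormedAlgebra 𝕜 ℂ] {r : ℕ} {k : ℤ}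

/-- The vector `e_a` of the standard basis of `ℤʳ`. -/
def stdVec (a : Fin r) : Fin r → ℤ := Pi.single a 1

/-- The coefficient of `zⁿ` in `e_-^{(a)}(∂/∂t' - ∂/∂t'', z) τ^{m'}(t') τ^{m''}(t'')`, which is
`(e_-^{(a)}(∂/∂t', z) τ^{m'}(t')) (e_-^{(a)}(-∂/∂t'', z) τ^{m''}(t''))`,
as a function of `t'` for fixed `t''`. -/
noncomputable def pairCoeff (τ : TauFunction 𝕜 r k) (a : Fin r) (m' m'' : Fin r → ℤ)
    (t'' : Times 𝕜 r) (n : ℤ) : Times 𝕜 r → ℂ :=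
  fun t' => if n ≤ 0 then
    ∑ q ∈ Finset.HasAntidiagonal.antidiagonal (-n).toNat,
      eMinus 1 a q.1 (τ.toFun m') t' * eMinus (-1) a q.2 (τ.toFun m'') t''
  else 0

/-- For a Laurent series `G = ∑ₙ Gₙ(t') zⁿ` one has
`∂/∂t'_j^{(b)} (e_+^{(a)}(t' - t'', z) G) = e_+^{(a)}(t' - t'', z) (∂G/∂t'_j^{(b)} + δ_{ab} zʲ G)`;
this is the operator `G ↦ ∂G/∂t'_j^{(b)} + δ_{ab} zʲ G`, for `i = (b, j)`. -/
noncomputable def twistedDeriv (a : Fin r) (i : Fin r × ℕ+) (G : ℤ → Times 𝕜 r → ℂ) :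
    ℤ → Times 𝕜 r → ℂ :=
  fun n t' => timeDeriv i (G n) t' + if i.1 = a then G (n - (i.2 : ℕ)) t' else 0

/-- The `p`-KdV bilinear equation
`Res_z ∑_a (-1)^{|m' + m''|_{a-1}} z^{m'_a - m''_a + ℓ p_a - 2} e_+^{(a)}(t' - t'', z)
  e_-^{(a)}(∂/∂t' - ∂/∂t'', z) τ^{m' - e_a}(t') τ^{m'' + e_a}(t'') = 0`
for `ℓ ≥ 0`, `|m'| = k + 1`, `|m''| = k - 1`. Its meaning is: for each finite family `l` of times,
apply the derivatives with respect to these times of `t'` inside the residue, and then set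
`t' = t'' = t` (so that `e_+^{(a)}(t' - t'', z)` becomes `1`). -/
def IsPKdV (τ : TauFunction 𝕜 r k) (p : Fin r → ℕ) : Prop :=
  ∀ (ℓ : ℕ) (m' m'' : Fin r → ℤ), ∑ a, m' a = k + 1 → ∑ a, m'' a = k - 1 →
    ∀ l : List (Fin r × ℕ+), ∀ t ∈ τ.domain,
      ∑ a : Fin r, (-1 : ℂ) ^ (∑ b ∈ Finset.univ.filter (fun b => b < a), (m' b + m'' b)) *
        l.foldr (twistedDeriv a) (τ.pairCoeff a (m' - stdVec a) (m'' + stdVec a) t)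
          (-1 - (m' a - m'' a + ℓ * p a - 2)) t = 0

/-- The coefficient of `z⁻ⁿ` in `P^ε_{ab}(m, t, z)`, for `ε = ±1`, where
`P^±_{ab}(m, t, ±z) = (-1)^{|e_a|_{b-1}} (z^{δ_{ab}-1} / τ^m(t)) e_-^{(b)}(±∂/∂t, z) τ^{m ± e_a ∓ e_b}(t)`.
-/
noncomputable def PCoeff (τ : TauFunction 𝕜 r k) (ε : ℤˣ) (m : Fin r → ℤ) (a b : Fin r) (n : ℕ)
    (t : Times 𝕜 r) : ℂ :=
  ((ε : ℤ) : ℂ) ^ n * (if a < b then -1 else 1) *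
    ((if a = b then eMinus ε b n (τ.toFun (m + (ε : ℤ) • (stdVec a - stdVec b))) t
      else if n = 0 then 0
      else eMinus ε b (n - 1) (τ.toFun (m + (ε : ℤ) • (stdVec a - stdVec b))) t) / τ.toFun m t)

section Reduction

variable [NeZero r]

/-- The indices `a` with `p_a = p_1`; as `p` is decreasing, these are `1, …, r_1`. -/
abbrev Top (p : Fin r → ℕ) : Type := {a : Fin r // p a = p 0}

/-- The indices `a` with `p_a ≠ p_1`; as `p` is decreasing, these are `r_1 + 1, …, r`. -/
abbrev Rest (p : Fin r → ℕ) : Type := {a : Fin r // p a ≠ p 0}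

/-- The times `t|_{t^{(a)} = 0 for a > r_1}`, with `t_1^{(a)}` translated by `x` for `a ≤ r_1`. -/
def reducedTimes (p : Fin r → ℕ) (t : Times 𝕜 r) (x : 𝕜) : Times 𝕜 r :=
  fun i => if p i.1 = p 0 then t i + (if i.2 = 1 then x else 0) else 0

/-- The finite set of the times `t_1^{(a)}` with `a ≤ r_1`. -/
def shiftedTimes (p : Fin r → ℕ) : Finset (Fin r × ℕ+) :=
  (Finset.univ.filter fun a => p a = p 0) ×ˢ {1}

theorem mem_shiftedTimes (p : Fin r → ℕ) (i : Fin r × ℕ+) :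
    i ∈ shiftedTimes p ↔ p i.1 = p 0 ∧ i.2 = 1 := by
  rw [shiftedTimes, Finset.mem_product, Finset.mem_filter, Finset.mem_singleton]
  simp

theorem reducedTimes_eq_shift (p : Fin r → ℕ) (t : Times 𝕜 r) (x y : 𝕜) :
    reducedTimes p t y = (reducedTimes p t x).shift (shiftedTimes p) (fun _ => y - x) := by
  funext i
  by_cases h1 : p i.1 = p 0 <;> by_cases h2 : i.2 = 1 <;>
    simp [reducedTimes, Times.shift, mem_shiftedTimes, h1, h2]

theorem contDiffAt_reducedTimes {D : Set (Times 𝕜 r)} {f : Times 𝕜 r → ℂ}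
    (hf : SmoothInTimes D f) (p : Fin r → ℕ) (t : Times 𝕜 r) (x : 𝕜)
    (hx : reducedTimes p t x ∈ D) : ContDiffAt 𝕜 ∞ (fun y => f (reducedTimes p t y)) x := by
  have e : (fun y => f (reducedTimes p t y)) = (fun s : shiftedTimes p → 𝕜 =>
      f ((reducedTimes p t x).shift (shiftedTimes p) s)) ∘ (fun y _ => y - x) :=
    funext fun y => congrArg f (reducedTimes_eq_shift p t x y)
  have h := hf _ hx (shiftedTimes p)
  have h' : ContDiffAt 𝕜 ∞ (fun (y : 𝕜) (_ : shiftedTimes p) => y - x) x := by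
    fun_prop
  have h0 : (fun _ => x - x : shiftedTimes p → 𝕜) = 0 := by
    funext; exact sub_self x
  rw [e]
  refine ContDiffAt.comp x ?_ h'
  rw [h0]
  exact h

/-- The set of all `x` such that `τ^m` is defined and nonzero at the reduced times translated
by `x`. -/
def region (τ : TauFunction 𝕜 r k) (p : Fin r → ℕ) (m : Fin r → ℤ) (hm : ∑ a, m a = k)
    (t : Times 𝕜 r) : TopologicalSpace.Opens 𝕜 where
  carrier := {x | reducedTimes p t x ∈ τ.domain ∧ τ.toFun m (reducedTimes p t x) ≠ 0}
  is_open' := by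
    rw [isOpen_iff_mem_nhds]
    rintro x ⟨hx, hx0⟩
    have h1 : ∀ᶠ y in 𝓝 x, reducedTimes p t y ∈ τ.domain := by
      have h := τ.finOpen _ hx (shiftedTimes p)
      have hc : ContinuousAt (fun (y : 𝕜) (_ : shiftedTimes p) => y - x) x := by
        fun_prop
      have h0 : (fun _ => x - x : shiftedTimes p → 𝕜) = 0 := by
        funext; exact sub_self x
      rw [← h0] at h
      filter_upwards [hc.eventually h] with y hy
      rwa [reducedTimes_eq_shift p t x y]
    have h2 := (contDiffAt_reducedTimes (τ.smooth m hm) p t x hx).continuousAt.eventually_ne hx0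
    filter_upwards [h1, h2] with y hy hy' using ⟨hy, hy'⟩

theorem sum_shift (ε : ℤˣ) (m : Fin r → ℤ) (hm : ∑ a, m a = k) (a b : Fin r) :
    ∑ c, (m + (ε : ℤ) • (stdVec a - stdVec b)) c = k := by
  simp [Finset.sum_add_distrib, hm, ← Finset.mul_sum, stdVec]

/-- `Q^ε_{ab;n}(m, x, t)`, the coefficient of `z⁻ⁿ` in `Q^ε_{ab}(m, x, t, z)`, as a smooth function
of `x`. -/
noncomputable def Q (τ : TauFunction 𝕜 r k) (p : Fin r → ℕ) (m : Fin r → ℤ) (hm : ∑ a, m a = k)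
    (t : Times 𝕜 r) (ε : ℤˣ) (a b : Fin r) (n : ℕ) : smoothFun (τ.region p m hm t) :=
  ⟨fun x => τ.PCoeff ε m a b n (reducedTimes p t x),
    fun x => τ.PCoeff ε m a b n (reducedTimes p t x), by
      rintro x ⟨hx, hx0⟩
      have h := τ.smooth _ (sum_shift ε m hm a b)
      simp only [PCoeff, div_eq_mul_inv]
      refine ContDiffAt.contDiffWithinAt (contDiffAt_const.mul (ContDiffAt.mul ?_
        ((contDiffAt_reducedTimes (τ.smooth m hm) p t x hx).inv hx0)))
      split_ifs
      · exact contDiffAt_reducedTimes (h.eMinus ε b n) p t x hx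
      · exact contDiffAt_const
      · exact contDiffAt_reducedTimes (h.eMinus ε b (n - 1)) p t x hx, fun _ => rfl⟩

variable (τ : TauFunction 𝕜 r k) (p : Fin r → ℕ) (m : Fin r → ℤ) (hm : ∑ a, m a = k)
  (t : Times 𝕜 r)

/-- The operator `Q⁺₁₁(m, x, t, ∂)`. -/
noncomputable def Q11 : Matrix (Top p) (Top p) (PDO (smoothFun (τ.region p m hm t))) :=
  Matrix.of fun a b => PDO.ofSeries fun n => τ.Q p m hm t 1 a b n

/-- The reduced Lax operators `L_a = Q⁺₁₁ ∘ E_{aa} ∂ ∘ (Q⁺₁₁)⁻¹`, for `a ≤ r_1`. -/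
noncomputable def lax (a : Top p) :
    Matrix (Top p) (Top p) (PDO (smoothFun (τ.region p m hm t))) :=
  τ.Q11 p m hm t * Matrix.single a a (PDO.monomial 1 1) * Ring.inverse (τ.Q11 p m hm t)

/-- The operator `L̃ = ∑_{a ≤ r_1} L_a^{p_1}`. -/
noncomputable def laxTilde : Matrix (Top p) (Top p) (PDO (smoothFun (τ.region p m hm t))) :=
  ∑ a : Top p, τ.lax p m hm t a ^ p 0

/-- The function `(-x)ⁱ / i!`. -/
noncomputable def expCoeff (i : ℕ) : smoothFun (τ.region p m hm t) :=
  ((i.factorial : ℂ)⁻¹) • (-smoothFun.X (τ.region p m hm t)) ^ i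

/-- The operator `W̃₁₂`, with entries
`∑_{j < p_b} ∑_{i ≤ j} ((-x)ⁱ / i!) Q⁺_{ab; j-i+1} ∂ʲ`. -/
noncomputable def W12 : Matrix (Top p) (Rest p) (PDO (smoothFun (τ.region p m hm t))) :=
  Matrix.of fun a b => ∑ j ∈ Finset.range (p b), ∑ i ∈ Finset.range (j + 1),
    PDO.monomial j (τ.expCoeff p m hm t i * τ.Q p m hm t 1 a b (j - i + 1))

/-- The operator `W̃₂₁`, with entries
`-∑_{j < p_a} ∑_{i ≤ j} (-∂)ʲ ∘ Q⁻_{ba; j-i+1} ((-x)ⁱ / i!)`. -/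
noncomputable def W21 : Matrix (Rest p) (Top p) (PDO (smoothFun (τ.region p m hm t))) :=
  Matrix.of fun a b => -∑ j ∈ Finset.range (p a), ∑ i ∈ Finset.range (j + 1),
    (-PDO.monomial 1 1) ^ j *
      PDO.monomial 0 (τ.Q p m hm t (-1) b a (j - i + 1) * τ.expCoeff p m hm t i)

/-- The operator `∑_{a > r_1} E_{aa} ∂^{-p_a}`. -/
noncomputable def middle : Matrix (Rest p) (Rest p) (PDO (smoothFun (τ.region p m hm t))) :=
  Matrix.diagonal fun a => PDO.monomial (-(p a : ℤ)) 1

/-- The operator `𝟙 ∂^{p_1}`. -/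
noncomputable def leadingTerm : Matrix (Top p) (Top p) (PDO (smoothFun (τ.region p m hm t))) :=
  Matrix.diagonal fun _ => PDO.monomial (p 0 : ℤ) 1

/-- The operator `W̃₁₁ = L̃₊ - 𝟙 ∂^{p_1} + (W̃₁₂ ∘ (∑_{a > r_1} E_{aa} ∂^{-p_a}) ∘ W̃₂₁)₊`. -/
noncomputable def W11 : Matrix (Top p) (Top p) (PDO (smoothFun (τ.region p m hm t))) :=
  (τ.laxTilde p m hm t).map PDO.plus - τ.leadingTerm p m hm t +
    (τ.W12 p m hm t * τ.middle p m hm t * τ.W21 p m hm t).map PDO.plus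

end Reduction

end TauFunction

/-! The bilinear equations are statements about residues of products of pseudodifferential
operators. Differentiating in `x` means summing `∂/∂t_1^{(a)}` over `a ≤ r_1`. On the component `c`
of the bilinear sum, `e_+^{(c)}` then contributes a factor `z` if `c ≤ r_1` and nothing otherwise
(`twist`). So `N` derivatives in `x` give, for `c ≤ r_1`, the residue of `∂^N ∘ τQ⁺_{ac}(∂) ∘
∂^{ℓp_1} ∘ Q⁻_{bc}(∂)^*`, and for `c > r_1` plain derivatives of coefficients of `τQ⁺_{ac}` times
coefficients of `Q⁻_{bc}(-z)`. The latter are residues too, since `Res ∂^N ∘ f∂⁻¹ ∘ g = f^{(N)} g`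
(`PDO.residue_D_pow_mul`). An operator whose left multiples by all `∂^N` have residue `0` is
differential (`PDO.isDifferential_of_residue`). Hence, after division by the unit `τ^m`, the `(a,
b)` entry of `Q⁺₁₁ ∘ ∂^{ℓp_1} ∘ (Q⁻₁₁)^*` plus `restTerm`, a finite sum of terms `f∂⁻¹ ∘ g`, is
differential (`TauFunction.isDifferential_add_restTerm`).

For `ℓ = 0` and `a, b ≤ r_1` the sum `restTerm` vanishes. Then `Q⁺₁₁ ∘ (Q⁻₁₁)^* - 1` is differential
and of negative order, so `(Q⁻₁₁)^*` is the inverse of `Q⁺₁₁` and `L̃ = Q⁺₁₁ ∘ ∂^{p_1} ∘ (Q⁻₁₁)^*`.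
For `ℓ = 1` it follows that `L̃ + restTerm` is differential.

It remains to compare `restTerm` with `W̃₁₂ ∘ (∑ E_{cc}∂^{-p_c}) ∘ W̃₂₁`. The coefficients of `W̃₁₂`
and `W̃₂₁` come from series multiplied by `exp(-xz)` and `exp(xz)`, and `exp(xz) ∘ ∂⁻¹ ∘ exp(-xz) =
(∂ - z)⁻¹ = ∑ z^n ∂^{-n-1}`. Comparing coefficients of `z^{p_c-1}` shows that both operators agree
up to differential ones (`PDO.isDifferential_sandwich`). So `L̃ + W̃₁₂ ∘ (∑ E_{cc}∂^{-p_c}) ∘ W̃₂₁`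
is differential, that is, equal to its own differential part, which is the claimed formula. The
order bounds are counts of degrees. -/

namespace PDO

/-! ### Differential parts, orders and elementary products. -/

section Generic

variable {R : Type*} [CommRing R]

theorem IsDifferential.add {a b : PDO R} (ha : a.IsDifferential) (hb : b.IsDifferential) :
    (a + b).IsDifferential := fun n hn => by rw [coeff_add, ha n hn, hb n hn, add_zero]

theorem IsDifferential.neg {a : PDO R} (ha : a.IsDifferential) : (-a).IsDifferential :=
  fun n hn => by rw [coeff_neg, ha n hn, neg_zero]

theorem IsDifferential.sub {a b : PDO R} (ha : a.IsDifferential) (hb : b.IsDifferential) :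
    (a - b).IsDifferential := sub_eq_add_neg a b ▸ ha.add hb.neg

theorem isDifferential_zero : (0 : PDO R).IsDifferential := fun _ _ => rfl

theorem OrderLE.neg {a : PDO R} {N : ℤ} (ha : a.OrderLE N) : (-a).OrderLE N :=
  fun n hn => by rw [coeff_neg, ha n hn, neg_zero]

theorem OrderLE.sub {a b : PDO R} {N : ℤ} (ha : a.OrderLE N) (hb : b.OrderLE N) :
    (a - b).OrderLE N := sub_eq_add_neg a b ▸ ha.add hb.neg

theorem orderLE_zero (N : ℤ) : (0 : PDO R).OrderLE N := fun _ _ => rfl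

theorem isDifferential_sum {ι : Type*} (s : Finset ι) (f : ι → PDO R)
    (h : ∀ i ∈ s, (f i).IsDifferential) : (∑ i ∈ s, f i).IsDifferential :=
  Finset.sum_induction _ _ (fun _ _ => IsDifferential.add) isDifferential_zero h

theorem orderLE_sum {ι : Type*} (s : Finset ι) (f : ι → PDO R) (N : ℤ)
    (h : ∀ i ∈ s, (f i).OrderLE N) : (∑ i ∈ s, f i).OrderLE N :=
  Finset.sum_induction f (OrderLE · N) (fun _ _ => OrderLE.add) (orderLE_zero N) h

theorem coeff_sub (a b : PDO R) (n : ℤ) : (a - b).coeff n = a.coeff n - b.coeff n := rfl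

theorem coeff_sum {ι : Type*} (s : Finset ι) (f : ι → PDO R) (n : ℤ) :
    (∑ i ∈ s, f i).coeff n = ∑ i ∈ s, (f i).coeff n :=
  map_sum (⟨⟨fun a : PDO R => a.coeff n, rfl⟩, fun _ _ => rfl⟩ : PDO R →+ R) f s

theorem isDifferential_monomial {n : ℤ} (hn : 0 ≤ n) (f : R) :
    (monomial n f).IsDifferential := fun k hk => if_neg (by omega)

theorem orderLE_monomial (n : ℤ) (f : R) : (monomial n f).OrderLE n :=
  fun _ hk => if_neg hk.ne'

theorem eq_zero_of_forall_orderLE {a : PDO R} (h : ∀ N : ℕ, a.OrderLE (-N)) : a = 0 := by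
  ext n
  exact h (-n + 1).toNat n (by omega)

theorem coeff_plus (a : PDO R) (n : ℤ) : a.plus.coeff n = if 0 ≤ n then a.coeff n else 0 := rfl

theorem isDifferential_plus (a : PDO R) : a.plus.IsDifferential :=
  fun n hn => by rw [coeff_plus, if_neg (by omega)]

theorem plus_add (a b : PDO R) : (a + b).plus = a.plus + b.plus := by
  ext n
  simp only [coeff_plus, coeff_add]
  split_ifs <;> simp

theorem IsDifferential.plus_eq {a : PDO R} (ha : a.IsDifferential) : a.plus = a := by
  ext n
  rw [coeff_plus]
  split_ifs with h
  · rfl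
  · rw [ha n (by omega)]

theorem OrderLE.plus {a : PDO R} {N : ℤ} (ha : a.OrderLE N) : a.plus.OrderLE N :=
  fun n hn => by rw [coeff_plus, ha n hn, ite_self]

theorem coeff_ofSeries (f : ℕ → R) (n : ℤ) :
    (ofSeries f).coeff n = if n ≤ 0 then f (-n).toNat else 0 := rfl

theorem orderLE_ofSeries (f : ℕ → R) : (ofSeries f).OrderLE 0 :=
  fun n hn => by rw [coeff_ofSeries, if_neg (by omega)]

theorem orderLE_ofSeries_sub_one {f : ℕ → R} (h : f 0 = 1) : (ofSeries f - 1).OrderLE (-1) := by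
  intro n hn
  rw [coeff_sub, coeff_ofSeries, coeff_one]
  obtain rfl | h0 := eq_or_ne n 0
  · simp [h]
  · rw [if_neg (by omega), if_neg h0, sub_zero]

theorem orderLE_ofSeries_neg_one {f : ℕ → R} (h : f 0 = 0) : (ofSeries f).OrderLE (-1) := by
  intro n hn
  rw [coeff_ofSeries]
  obtain rfl | h0 := eq_or_ne n 0
  · simp [h]
  · rw [if_neg (by omega)]

theorem isDifferential_one : (1 : PDO R).IsDifferential := isDifferential_monomial le_rfl 1

theorem monomial_zero_one : (monomial 0 1 : PDO R) = 1 := rfl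

variable [Differential R]

theorem coeff_monomial_zero_mul (f : R) (a : PDO R) (n : ℤ) :
    (monomial 0 f * a).coeff n = f * a.coeff n := by
  rw [coeff_mul, mulCoeff, finsum_eq_single _ ((0 : ℤ), 0)]
  · simp
  · rintro ⟨i, k⟩ h
    by_cases hi : i = 0
    · subst hi
      have hk : 0 < k := Nat.pos_of_ne_zero fun hk => h (by rw [hk])
      simp [Ring.choose_zero_pos ℤ hk]
    · simp [hi]

theorem coeff_mul_monomial_one (a : PDO R) (s n : ℤ) :
    (a * monomial s 1).coeff n = a.coeff (n - s) := by
  rw [coeff_mul, mulCoeff, finsum_eq_single _ (n - s, 0)]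
  · simp
  · rintro ⟨i, k⟩ h
    by_cases hk : n - i + k = s
    · have hk0 : k ≠ 0 := by
        rintro rfl
        exact h (by rw [show i = n - s by simp at hk; omega])
      simp [hk, iter_one, hk0]
    · simp [hk]

theorem monomial_mul_monomial_one (i j : ℤ) (f : R) :
    monomial i f * monomial j 1 = monomial (i + j) f := by
  ext n
  simp only [coeff_mul_monomial_one, coeff_monomial]
  congr 1
  simp only [eq_iff_iff]
  omega

theorem monomial_one_pow (i : ℤ) (n : ℕ) : (monomial i (1 : R)) ^ n = monomial (i * n) 1 := by
  induction n with
  | zero => simp [monomial_zero_one]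
  | succ n ih =>
    rw [pow_succ, ih, monomial_mul_monomial_one]
    congr 1
    push_cast; ring

theorem coeff_D_mul (a : PDO R) (n : ℤ) :
    (monomial 1 1 * a).coeff n = Differential.deriv (a.coeff n) + a.coeff (n - 1) := by
  rw [coeff_mul, mulCoeff, finsum_eq_sum_of_support_subset (s := {((1 : ℤ), 0), ((1 : ℤ), 1)})]
  · rw [Finset.sum_pair (by simp)]
    simp [add_comm]
  · rintro ⟨i, k⟩ h
    rw [Function.mem_support] at h
    by_cases hi : i = 1
    · subst hi
      have hk : k < 2 := by
        by_contra hk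
        have := Ring.choose_natCast (R := ℤ) 1 k
        rw [Nat.choose_eq_zero_of_lt (by omega)] at this
        simp only [Nat.cast_one, Nat.cast_zero] at this
        exact h (by simp [this])
      interval_cases k <;> simp
    · exact absurd (by simp [hi]) h

/-- A term with `k ≥ 1` derivatives on `h` reaches `∂⁻¹` only from `∂^{k-1}`, and there `binom(k-1,
k) = 0`. -/
theorem residue_mul_monomial_zero (a : PDO R) (h : R) :
    (a * monomial 0 h).coeff (-1) = a.coeff (-1) * h := by
  rw [coeff_mul, mulCoeff, finsum_eq_single _ ((-1 : ℤ), 0)]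
  · simp
  · rintro ⟨i, k⟩ hne
    by_cases hk : -1 - i + k = 0
    · have hk0 : k ≠ 0 := by
        rintro rfl
        exact hne (by rw [show i = -1 by simp at hk; omega])
      have := Ring.choose_natCast (R := ℤ) (k - 1) k
      rw [Nat.choose_eq_zero_of_lt (by omega), show ((k - 1 : ℕ) : ℤ) = i by omega] at this
      simp [this]
    · simp [hk]

theorem IsDifferential.mul {a b : PDO R} (ha : a.IsDifferential) (hb : b.IsDifferential) :
    (a * b).IsDifferential := by
  intro n hn
  rw [coeff_mul, mulCoeff]
  refine finsum_eq_zero_of_forall_eq_zero ?_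
  rintro ⟨i, k⟩
  by_cases hi : i < 0
  · simp [ha i hi]
  by_cases hk : n - i + k < 0
  · simp [hb _ hk]
  -- Here `i ≥ 0` and `k ≥ i - n > i`, so the binomial coefficient vanishes.
  have := Ring.choose_natCast (R := ℤ) i.toNat k
  rw [Nat.choose_eq_zero_of_lt (by omega), show ((i.toNat : ℕ) : ℤ) = i by omega] at this
  simp [this]

theorem IsDifferential.pow {a : PDO R} (ha : a.IsDifferential) (n : ℕ) :
    (a ^ n).IsDifferential := by
  induction n with
  | zero => simpa using isDifferential_one
  | succ n ih => rw [pow_succ]; exact ih.mul ha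

/-! ### Residues and formal adjoints. -/

/-- An operator all of whose left multiples by powers of `∂` have no residue is differential. -/
theorem isDifferential_of_residue (a : PDO R)
    (h : ∀ N : ℕ, (monomial 1 1 ^ N * a).coeff (-1) = 0) : a.IsDifferential := by
  -- The operator varies in the induction: the hypothesis passes from `a` to `∂ ∘ a`, whose
  -- coefficient at `∂^{-1-n}` is `(a_{-1-n})' + a_{-2-n}`.
  suffices H : ∀ (n : ℕ) (a : PDO R), (∀ N : ℕ, (monomial 1 1 ^ N * a).coeff (-1) = 0) →
      a.coeff (-1 - n) = 0 by
    intro n hn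
    have := H (-1 - n).toNat a h
    rwa [show -1 - ((-1 - n).toNat : ℤ) = n by omega] at this
  intro n
  induction n with
  | zero => intro a h; simpa using h 0
  | succ n ih =>
    intro a h
    have h1 := ih (monomial 1 1 * a) fun N => by
      rw [← mul_assoc, ← pow_succ]; exact h (N + 1)
    rw [coeff_D_mul, ih a h, map_zero, zero_add] at h1
    rw [← h1]
    congr 1
    push_cast; ring

/-- Multiplication operators. -/
noncomputable def C : R →+* PDO R where
  toFun := monomial 0
  map_one' := rfl
  map_mul' f g := by
    ext n
    rw [coeff_monomial_zero_mul]
    simp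
  map_zero' := by ext n; simp
  map_add' f g := by
    ext n
    simp only [coeff_add, coeff_monomial]
    split_ifs <;> simp

theorem C_apply (f : R) : C f = monomial 0 f := rfl

theorem coeff_C_mul (f : R) (a : PDO R) (n : ℤ) : (C f * a).coeff n = f * a.coeff n :=
  coeff_monomial_zero_mul f a n

theorem C_mul_monomial_one (f : R) (n : ℤ) : C f * monomial n 1 = monomial n f := by
  rw [C_apply, monomial_mul_monomial_one, zero_add]

theorem isDifferential_C (f : R) : (C f).IsDifferential := isDifferential_monomial le_rfl f

theorem orderLE_C (f : R) : (C f).OrderLE 0 := orderLE_monomial 0 f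

theorem D_mul_C (f : R) :
    monomial 1 1 * C f = C (Differential.deriv f) + C f * monomial 1 1 := by
  ext n
  rw [coeff_D_mul, C_mul_monomial_one, C_apply, C_apply]
  simp only [coeff_monomial, coeff_add]
  rw [apply_ite Differential.deriv, map_zero]
  congr 2
  simp only [eq_iff_iff]
  omega

/-- Since `∂ ∘ f∂⁻¹ = f'∂⁻¹ + f`, each factor `∂` differentiates `f` once, up to a differential
operator without residue. -/
theorem residue_D_pow_mul (N : ℕ) (f g : R) :
    (monomial 1 1 ^ N * (C f * monomial (-1) 1 * C g)).coeff (-1)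
      = Differential.deriv^[N] f * g := by
  rw [← mul_assoc, C_apply g, residue_mul_monomial_zero]
  congr 1
  induction N generalizing f with
  | zero => simp [C_mul_monomial_one]
  | succ N ih =>
    rw [pow_succ, mul_assoc, ← mul_assoc (monomial 1 1) (C f), D_mul_C, add_mul, mul_assoc (C f),
      monomial_mul_monomial_one, mul_add, coeff_add, ih, add_neg_cancel, monomial_zero_one, mul_one,
      ((isDifferential_monomial zero_le_one 1).pow N).mul (isDifferential_C f) (-1) (by omega),
      add_zero, Function.iterate_succ_apply]

/-- The operator `∑_{q ≥ 0} ∂^{-q} ∘ h_q`, the formal adjoint of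
`∑_{q ≥ 0} (-1)^q h_q ∂^{-q}`. -/
noncomputable def coadj (h : ℕ → R) : PDO R :=
  -- The infinite sum is defined coefficientwise: `∂^{-q} ∘ h_q` has order at most `-q`, so only `q
  -- ≤ n` reach `∂^{-n}`.
  ofSeries fun n => (∑ q ∈ Finset.range (n + 1), monomial (-q : ℤ) 1 * C (h q)).coeff (-n)

theorem orderLE_coadj_sub (h : ℕ → R) (K : ℕ) :
    (coadj h - ∑ q ∈ Finset.range K, monomial (-q : ℤ) 1 * C (h q)).OrderLE (-K) := by
  have hq : ∀ q : ℕ, (monomial (-q : ℤ) 1 * C (h q)).OrderLE (-q) := fun q => by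
    simpa using (orderLE_monomial (-q : ℤ) (1 : R)).mul (orderLE_C (h q))
  intro n hn
  rw [coeff_sub, coadj, coeff_ofSeries]
  by_cases h0 : n ≤ 0
  · rw [if_pos h0, show -((-n).toNat : ℤ) = n by omega, coeff_sum, coeff_sum, sub_eq_zero]
    refine Finset.sum_subset (fun q hq => ?_) fun q _ hq' => ?_
    · rw [Finset.mem_range] at *; omega
    · rw [Finset.mem_range] at hq'
      exact hq q n (by omega)
  · rw [if_neg h0, zero_sub, coeff_sum, Finset.sum_eq_zero, neg_zero]
    exact fun q _ => hq q n (by omega)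

theorem orderLE_coadj_sub_C (h : ℕ → R) : (coadj h - C (h 0)).OrderLE (-1) := by
  simpa [monomial_zero_one] using orderLE_coadj_sub h 1

theorem orderLE_coadj (h : ℕ → R) : (coadj h).OrderLE 0 := orderLE_ofSeries _

/-- With functions on the right of the powers of `∂`, no derivative survives in the residue, so it
is the residue of the product of symbols. Truncation at `K` is harmless because the remainder has
order below `-1`. -/
theorem residue_mul_coadj {a : PDO R} {M : ℤ} (ha : a.OrderLE M) (s : ℤ) (h : ℕ → R) (K : ℕ)
    (hK : M + s + 1 < K) :
    (a * monomial s 1 * coadj h).coeff (-1)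
      = ∑ q ∈ Finset.range K, a.coeff (-1 - s + q) * h q := by
  have h1 := ((ha.mul (orderLE_monomial s 1)).mul (orderLE_coadj_sub h K)) (-1) (by omega)
  rw [mul_sub, coeff_sub, sub_eq_zero] at h1
  rw [h1, Finset.mul_sum, coeff_sum]
  refine Finset.sum_congr rfl fun q _ => ?_
  rw [← mul_assoc, C_apply, residue_mul_monomial_zero, coeff_mul_monomial_one,
    coeff_mul_monomial_one]
  congr 2
  ring

/-! ### Matrices of operators. -/

section Matrix

variable {n : Type*} [Fintype n]

theorem matrix_orderLE_mul {l o : Type*} {A : Matrix l n (PDO R)} {B : Matrix n o (PDO R)}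
    {M N : ℤ} (hA : ∀ i j, (A i j).OrderLE M) (hB : ∀ i j, (B i j).OrderLE N) (i : l) (j : o) :
    ((A * B) i j).OrderLE (M + N) := by
  rw [Matrix.mul_apply]
  exact orderLE_sum _ _ _ fun c _ => (hA i c).mul (hB c j)

/-- The defect `E = BA - 1` satisfies `AE = 0`, hence `E = -(A - 1)E`. As `A - 1` has negative
order, any order bound for `E` can be lowered indefinitely. -/
theorem matrix_mul_eq_one_symm [DecidableEq n] {A B : Matrix n n (PDO R)}
    (hA : ∀ i j, ((A - 1) i j).OrderLE (-1)) (h : A * B = 1) : B * A = 1 := by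
  have hE : B * A - 1 = -((A - 1) * (B * A - 1)) := by
    have : A * (B * A - 1) = 0 := by rw [mul_sub, ← mul_assoc, h, one_mul, mul_one, sub_self]
    rw [sub_mul, this, one_mul, zero_sub, neg_neg]
  rw [← sub_eq_zero]
  -- A common order bound exists because there are finitely many entries.
  have hbound : ∃ M : ℤ, ∀ i j, ((B * A - 1) i j).OrderLE M := by
    choose N hN using fun q : n × n => ((B * A - 1) q.1 q.2).exists_orderLE
    obtain ⟨M, hM⟩ := (Set.finite_range N).bddAbove
    exact ⟨M, fun i j => (hN (i, j)).mono (hM ⟨(i, j), rfl⟩)⟩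
  obtain ⟨M, hM⟩ := hbound
  have step : ∀ k : ℕ, ∀ i j, ((B * A - 1) i j).OrderLE (M - k) := by
    intro k
    induction k with
    | zero => simpa using hM
    | succ k ih =>
      intro i j
      rw [hE, Matrix.neg_apply]
      refine ((matrix_orderLE_mul hA ih i j).mono ?_).neg
      push_cast; omega
  ext1 i j
  rw [Matrix.zero_apply]
  exact eq_zero_of_forall_orderLE fun N => (step (M + N).toNat i j).mono (by omega)

end Matrix

/-! ### Conjugation of `∂⁻¹` by the exponential series. -/

section Exponential

open PowerSeries

/-- If `e = ∑ eₙ zⁿ` satisfies `∂ e = z e` and `e e' = 1`, then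
`e ∘ ∂⁻¹ ∘ e' = (∂ - z)⁻¹ = ∑ₙ ∂⁻ⁿ⁻¹ zⁿ`. -/
theorem conj_exp_eq (e e' : R⟦X⟧) (h0 : Differential.deriv (PowerSeries.coeff 0 e) = 0)
    (h1 : ∀ n, Differential.deriv (PowerSeries.coeff (n + 1) e) = PowerSeries.coeff n e) (he : e * e' = 1) :
    PowerSeries.map C e * PowerSeries.C (monomial (-1) 1) * PowerSeries.map C e'
      = PowerSeries.mk fun n => monomial (-(n + 1 : ℤ)) (1 : R) := by
  set E := PowerSeries.map C e * PowerSeries.C (monomial (-1) (1 : R)) * PowerSeries.map C e'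
    with hE
  have comm : PowerSeries.C (monomial 1 (1 : R)) * PowerSeries.map C e
      = X * PowerSeries.map C e
        + PowerSeries.map C e * PowerSeries.C (monomial 1 (1 : R)) := by
    ext1 n
    rw [map_add, PowerSeries.coeff_C_mul, PowerSeries.coeff_mul_C, PowerSeries.coeff_map, D_mul_C]
    cases n with
    | zero => rw [h0, map_zero, PowerSeries.coeff_zero_X_mul]
    | succ n => rw [h1, PowerSeries.coeff_succ_X_mul, PowerSeries.coeff_map]
  -- This is `(∂ - z)E = 1`; since `∂` is invertible, it determines the coefficients of `E`
  -- recursively.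
  have key : PowerSeries.C (monomial 1 (1 : R)) * E = X * E + 1 := by
    rw [hE, ← mul_assoc, ← mul_assoc, comm, add_mul, add_mul, mul_assoc (PowerSeries.map C e),
      ← map_mul PowerSeries.C, monomial_mul_monomial_one, add_neg_cancel, monomial_zero_one,
      map_one, mul_one, ← map_mul, he, map_one]
    simp only [mul_assoc]
  have inv : ∀ a b : PDO R, monomial 1 1 * a = b → a = monomial (-1) 1 * b := by
    rintro a b rfl
    rw [← mul_assoc, monomial_mul_monomial_one, neg_add_cancel, monomial_zero_one, one_mul]
  ext1 n
  rw [PowerSeries.coeff_mk]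
  induction n with
  | zero =>
    have := congrArg (PowerSeries.coeff 0) key
    rw [PowerSeries.coeff_C_mul, map_add, PowerSeries.coeff_zero_X_mul, zero_add, PowerSeries.coeff_one, if_pos rfl] at this
    rw [inv _ _ this, mul_one]
    simp
  | succ n ih =>
    have := congrArg (PowerSeries.coeff (n + 1)) key
    rw [PowerSeries.coeff_C_mul, map_add, PowerSeries.coeff_succ_X_mul, PowerSeries.coeff_one, if_neg (by omega), add_zero, ih] at this
    rw [inv _ _ this, monomial_mul_monomial_one]
    congr 1
    push_cast; ring

/-- Up to differential operators, `∑_{i,j < s} fᵢ ∂ⁱ ∘ ∂⁻ˢ ∘ ∂ʲ ∘ gⱼ` is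
`∑_{i+j=s-1} uᵢ ∂⁻¹ ∘ vⱼ`, where `f = e' u` and `g = e v`. -/
theorem isDifferential_sandwich (e e' u v : R⟦X⟧) (h0 : Differential.deriv (PowerSeries.coeff 0 e) = 0)
    (h1 : ∀ n, Differential.deriv (PowerSeries.coeff (n + 1) e) = PowerSeries.coeff n e) (he : e * e' = 1) (s : ℕ) :
    ((∑ i ∈ Finset.range (s + 1), monomial i (PowerSeries.coeff i (e' * u))) * monomial (-(s + 1 : ℤ)) 1 *
      (∑ j ∈ Finset.range (s + 1), monomial j 1 * C (PowerSeries.coeff j (e * v))) -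
      ∑ q ∈ Finset.HasAntidiagonal.antidiagonal s,
        C (PowerSeries.coeff q.1 u) * monomial (-1) 1 * C (PowerSeries.coeff q.2 v)).IsDifferential := by
  -- The factors `e'` and `e` of `f` and `g` undo the conjugation: `e'u ∘ (e ∘ ∂⁻¹ ∘ e') ∘ ev = u∂⁻¹
  -- ∘ v`.
  have hprod : PowerSeries.map C (e' * u) *
      (PowerSeries.mk fun n => monomial (-(n + 1 : ℤ)) (1 : R)) * PowerSeries.map C (e * v)
      = PowerSeries.map C u * PowerSeries.C (monomial (-1) 1) * PowerSeries.map C v := by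
    rw [← conj_exp_eq e e' h0 h1 he, mul_comm e' u, mul_comm e v]
    have h3 : PowerSeries.map C e' * PowerSeries.map C e = (1 : (PDO R)⟦X⟧) := by
      rw [← map_mul, mul_comm, he, map_one]
    have h4 : e' * (v * e) = v := by rw [mul_comm v e, ← mul_assoc, mul_comm e', he, one_mul]
    calc _ = PowerSeries.map C u * (PowerSeries.map C e' * PowerSeries.map C e) *
        PowerSeries.C (monomial (-1) (1 : R)) *
          (PowerSeries.map C e' * PowerSeries.map C (v * e)) := by
          simp only [map_mul, mul_assoc]
      _ = _ := by rw [h3, mul_one, ← map_mul, h4]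
  have hs := congrArg (PowerSeries.coeff s) hprod
  simp only [PowerSeries.coeff_mul (R := PDO R) s, PowerSeries.coeff_mul_C, PowerSeries.coeff_map]
    at hs
  simp only [PowerSeries.coeff_mul (R := PDO R), PowerSeries.coeff_map, PowerSeries.coeff_mk,
    Finset.sum_mul, Finset.sum_sigma'] at hs
  rw [← hs]
  set f := e' * u
  set g := e * v
  have hterm : ∀ i j : ℕ, monomial (i : ℤ) (PowerSeries.coeff i f) * monomial (-(s + 1 : ℤ)) 1 *
      (monomial (j : ℤ) 1 * C (PowerSeries.coeff j g))
      = C (PowerSeries.coeff i f) * monomial (i + j - s - 1 : ℤ) 1 * C (PowerSeries.coeff j g) := by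
    intro i j
    rw [← mul_assoc, monomial_mul_monomial_one, monomial_mul_monomial_one, C_mul_monomial_one]
    congr 2
    ring
  rw [Finset.sum_mul, Finset.sum_mul_sum]
  simp only [hterm]
  -- The exponent is `i + j - s - 1`: pairs with `i + j > s` give differential operators, the others
  -- match `∂^{-n-1}` with `n = s - i - j`.
  rw [← Finset.sum_product', ← Finset.sum_filter_add_sum_filter_not _ fun q => q.1 + q.2 ≤ s]
  rw [add_comm, add_sub_assoc]
  refine IsDifferential.add (isDifferential_sum _ _ fun q hq => ?_) ?_
  · rw [Finset.mem_filter] at hq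
    exact ((isDifferential_C _).mul (isDifferential_monomial (by omega) 1)).mul (isDifferential_C _)
  · rw [Finset.sum_nbij' (i := fun q => (⟨(s - q.2, q.2), (q.1, s - q.2 - q.1)⟩ :
      (_ : ℕ × ℕ) × (ℕ × ℕ))) (j := fun w => (w.2.1, w.1.2))
      (t := (Finset.HasAntidiagonal.antidiagonal s).sigma fun x =>
        Finset.HasAntidiagonal.antidiagonal x.1), sub_eq_zero.2 rfl]
    · exact isDifferential_zero
    · rintro ⟨i, j⟩ h
      simp only [Finset.mem_filter, Finset.mem_product, Finset.mem_range, Finset.mem_sigma,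
        Finset.HasAntidiagonal.mem_antidiagonal] at h ⊢
      omega
    · rintro ⟨⟨a, j⟩, ⟨i, n⟩⟩ h
      simp only [Finset.mem_filter, Finset.mem_product, Finset.mem_range, Finset.mem_sigma,
        Finset.HasAntidiagonal.mem_antidiagonal] at h ⊢
      omega
    · rintro ⟨i, j⟩ h
      rfl
    · rintro ⟨⟨a, j⟩, ⟨i, n⟩⟩ h
      simp only [Finset.mem_sigma, Finset.HasAntidiagonal.mem_antidiagonal] at h ⊢
      obtain ⟨h1, h2⟩ := h
      subst h2 h1
      simp
    · rintro ⟨i, j⟩ h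
      simp only [Finset.mem_filter, Finset.mem_product, Finset.mem_range] at h
      congr 3
      push_cast [Nat.sub_sub, Nat.cast_sub (show j + i ≤ s by omega)]
      ring

end Exponential

end Generic

end PDO

/-! ### Differentiation in the presence of a factor `exp(δxz)`. -/

section Twist

variable {R : Type*} [CommRing R] [Differential R]

/-- The operator `G ↦ ∂G + δ z G` on families `G = ∑ₖ Gₖ zᵏ`. -/
noncomputable def twist (δ : R) : AddMonoid.End (ℤ → R) where
  toFun F := fun k => Differential.deriv (F k) + δ * F (k - 1)
  map_zero' := by funext k; simp
  map_add' F G := by funext k; simp only [Pi.add_apply, map_add]; ring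

theorem twist_apply (δ : R) (F : ℤ → R) (k : ℤ) :
    twist δ F k = Differential.deriv (F k) + δ * F (k - 1) := rfl

theorem twist_pow_succ_apply (δ : R) (N : ℕ) (F : ℤ → R) :
    (twist δ ^ (N + 1)) F = (twist δ ^ N) (twist δ F) := by rw [pow_succ]; rfl

/-- On symbols, left composition with `∂` is `∂_x + z`. -/
theorem twist_one_pow_coeff (N : ℕ) (a : PDO R) :
    (twist 1 ^ N) a.coeff = (PDO.monomial 1 1 ^ N * a).coeff := by
  induction N generalizing a with
  | zero => rw [pow_zero, pow_zero, one_mul]; rfl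
  | succ N ih =>
    have : twist 1 a.coeff = (PDO.monomial 1 1 * a).coeff := by
      funext k
      rw [PDO.coeff_D_mul, twist_apply, one_mul]
    rw [twist_pow_succ_apply, this, ih, pow_succ, mul_assoc]

theorem twist_zero_pow_apply (N : ℕ) (F : ℤ → R) (k : ℤ) :
    (twist 0 ^ N) F k = Differential.deriv^[N] (F k) := by
  induction N generalizing F with
  | zero => rfl
  | succ N ih =>
    rw [twist_pow_succ_apply, ih, twist_apply, zero_mul, add_zero, Function.iterate_succ_apply]

/-- Factors `h q` constant in `x` pass through the twist. Each application may raise the top power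
of `z` by one, so the truncation bound grows with `N`. -/
theorem twist_pow_conv (δ : R) {h : ℕ → R} (hh : ∀ q, Differential.deriv (h q) = 0) (N : ℕ)
    {F Φ : ℤ → R} {M : ℤ}
    (hΦ : ∀ (k : ℤ) (K : ℕ), M - k < K → Φ k = ∑ q ∈ Finset.range K, F (k + q) * h q)
    (k : ℤ) (K : ℕ) (hK : M + N - k < K) :
    (twist δ ^ N) Φ k = ∑ q ∈ Finset.range K, (twist δ ^ N) F (k + q) * h q := by
  induction N generalizing F Φ M with
  | zero => exact hΦ k K (by simpa using hK)
  | succ N ih =>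
    rw [twist_pow_succ_apply, twist_pow_succ_apply]
    refine ih (M := M + 1) (fun k K hK => ?_) (by push_cast at hK; omega)
    rw [twist_apply, hΦ k K (by omega), hΦ (k - 1) K (by omega), map_sum, Finset.mul_sum,
      ← Finset.sum_add_distrib]
    refine Finset.sum_congr rfl fun q _ => ?_
    rw [Derivation.leibniz, hh, twist_apply, show k - 1 + (q : ℤ) = k + q - 1 by ring]
    simp only [smul_eq_mul]
    ring

end Twist

/-! ### Derivatives of smooth functions of `x`. -/

namespace smoothFun

variable {𝕜 : Type*} [RCLike 𝕜] [NormedAlgebra 𝕜 ℂ] {U : TopologicalSpace.Opens 𝕜}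

theorem deriv_apply (f : smoothFun U) (g : 𝕜 → ℂ) (e : ∀ u : U, f.1 u = g u) (u : U) :
    (Differential.deriv f).1 u = deriv g u :=
  (zeroExt_eventuallyEq f.1 g e u).deriv_eq

theorem deriv_algebraMap (c : ℂ) : Differential.deriv (algebraMap ℂ (smoothFun U) c) = 0 := by
  refine Subtype.ext (funext fun u => ?_)
  rw [deriv_apply _ (fun _ => c) (fun _ => rfl)]
  simp

theorem deriv_X : Differential.deriv (X U) = 1 := by
  refine Subtype.ext (funext fun u => ?_)
  rw [deriv_apply _ (fun x => algebraMap 𝕜 ℂ x) (fun _ => rfl)]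
  have h : HasDerivAt (fun x => algebraMap 𝕜 ℂ x) (algebraMap 𝕜 ℂ 1) (u : 𝕜) :=
    (algebraMapCLM 𝕜 ℂ).hasDerivAt
  rw [h.deriv, map_one]
  rfl

theorem deriv_smul (c : ℂ) (f : smoothFun U) :
    Differential.deriv (c • f) = c • Differential.deriv f := by
  rw [Algebra.smul_def, Derivation.leibniz, deriv_algebraMap, smul_zero, add_zero, smul_eq_mul,
    Algebra.smul_def]

theorem sum_apply {ι : Type*} (s : Finset ι) (f : ι → smoothFun U) (u : U) :
    (∑ i ∈ s, f i).1 u = ∑ i ∈ s, (f i).1 u := by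
  rw [AddSubmonoidClass.coe_finsetSum, Finset.sum_apply]

end smoothFun

/-! ### The chain rule for functions of the times. -/

section Chain

variable {r : ℕ}

theorem Times.shift_single {𝕜 : Type*} [RCLike 𝕜] (t : Times 𝕜 r) (S : Finset (Fin r × ℕ+)) (i : S) (h : 𝕜) :
    t.shift S (Pi.single i h) = t + Pi.single (i : Fin r × ℕ+) h := by
  classical
  funext q
  by_cases hq : q = i
  · subst hq
    simp [Times.shift]
  · by_cases hS : q ∈ S <;> simp [Times.shift, hq, hS, Subtype.ext_iff]

variable {𝕜 : Type*} [RCLike 𝕜] [NormedAlgebra 𝕜 ℂ]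

theorem SmoothInTimes.add {D : Set (Times 𝕜 r)} {f g : Times 𝕜 r → ℂ}
    (hf : SmoothInTimes D f) (hg : SmoothInTimes D g) : SmoothInTimes D fun t => f t + g t :=
  fun t ht S => (hf t ht S).add (hg t ht S)

theorem SmoothInTimes.mul {D : Set (Times 𝕜 r)} {f g : Times 𝕜 r → ℂ}
    (hf : SmoothInTimes D f) (hg : SmoothInTimes D g) : SmoothInTimes D fun t => f t * g t :=
  fun t ht S => (hf t ht S).mul (hg t ht S)

theorem smoothInTimes_const (D : Set (Times 𝕜 r)) (c : ℂ) : SmoothInTimes D fun _ => c :=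
  fun _ _ _ => contDiffAt_const

theorem SmoothInTimes.sum {D : Set (Times 𝕜 r)} {ι : Type*} (s : Finset ι)
    {f : ι → Times 𝕜 r → ℂ} (hf : ∀ i ∈ s, SmoothInTimes D (f i)) :
    SmoothInTimes D fun t => ∑ i ∈ s, f i t :=
  fun t ht S => ContDiffAt.sum fun i hi => hf i hi t ht S

theorem timeDeriv_eq_fderiv {D : Set (Times 𝕜 r)} {f : Times 𝕜 r → ℂ} (hf : SmoothInTimes D f)
    {t : Times 𝕜 r} (ht : t ∈ D) (S : Finset (Fin r × ℕ+)) (i : S) :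
    timeDeriv (i : Fin r × ℕ+) f t
      = fderiv 𝕜 (fun s : S → 𝕜 => f (t.shift S s)) 0 (Pi.single i 1) := by
  classical
  have hd : DifferentiableAt 𝕜 (fun s : S → 𝕜 => f (t.shift S s)) 0 :=
    (hf t ht S).differentiableAt (by simp)
  have hl : HasDerivAt (fun h : 𝕜 => (Pi.single i h : S → 𝕜)) (Pi.single i 1) 0 :=
    hasDerivAt_single i 0
  have h0 : HasFDerivAt (fun s : S → 𝕜 => f (t.shift S s))
      (fderiv 𝕜 (fun s : S → 𝕜 => f (t.shift S s)) 0) (Pi.single i (0 : 𝕜)) := by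
    rw [Pi.single_zero]; exact hd.hasFDerivAt
  have := (h0.comp_hasDerivAt (0 : 𝕜) hl).deriv
  rw [← this, timeDeriv]
  congr 1
  funext h
  simp only [Function.comp, Times.shift_single]

end Chain

namespace TauFunction

section Reduce

variable {𝕜 : Type*} [RCLike 𝕜] [NormedAlgebra 𝕜 ℂ] {r : ℕ} [NeZero r]

/-- Chain rule along the diagonal translation: all the times `t_1^{(a)}` with `a ≤ r_1` move with
unit speed. -/
theorem deriv_reducedTimes {D : Set (Times 𝕜 r)} {f : Times 𝕜 r → ℂ} (hf : SmoothInTimes D f)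
    (p : Fin r → ℕ) (t : Times 𝕜 r) (x : 𝕜) (hx : reducedTimes p t x ∈ D) :
    deriv (fun y => f (reducedTimes p t y)) x
      = ∑ i ∈ shiftedTimes p, timeDeriv i f (reducedTimes p t x) := by
  classical
  set S := shiftedTimes p
  set F : (S → 𝕜) → ℂ := fun s => f ((reducedTimes p t x).shift S s) with hF
  have e : (fun y => f (reducedTimes p t y)) = F ∘ (fun y _ => y - x) :=
    funext fun y => congrArg f (reducedTimes_eq_shift p t x y)
  have hd : DifferentiableAt 𝕜 F 0 := (hf _ hx S).differentiableAt (by simp)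
  have h0 : (fun _ => x - x : S → 𝕜) = 0 := by
    funext; exact sub_self x
  have hl : HasDerivAt (fun (y : 𝕜) (_ : S) => y - x) (fun _ => 1) x :=
    hasDerivAt_pi.2 fun _ => (hasDerivAt_id x).sub_const x
  have h1 : HasFDerivAt F (fderiv 𝕜 F 0) ((fun (y : 𝕜) (_ : S) => y - x) x) := by
    change HasFDerivAt F _ (fun _ => x - x)
    rw [h0]; exact hd.hasFDerivAt
  rw [e, (h1.comp_hasDerivAt x hl).deriv, ← Finset.sum_coe_sort S]
  have h2 : (fun _ => 1 : S → 𝕜) = ∑ i : S, Pi.single i 1 := by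
    rw [Finset.univ_sum_single]
  rw [h2, map_sum]
  exact Finset.sum_congr rfl fun i _ => (timeDeriv_eq_fderiv hf hx S i).symm

end Reduce

end TauFunction

/-- A Cauchy product, written as a sum over a range of any sufficient length since `PDO.ofSeries`
vanishes in positive degrees. -/
theorem sum_range_ofSeries_mul {R : Type*} [CommRing R] (f g : ℕ → R) (k : ℤ) (K : ℕ)
    (hK : 0 - k < K) :
    ∑ q ∈ Finset.range K, (PDO.ofSeries f).coeff (k + q) * g q
      = if k ≤ 0 then
          PowerSeries.coeff (-k).toNat (PowerSeries.mk f * PowerSeries.mk g) else 0 := by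
  simp only [PDO.coeff_ofSeries, ite_mul, zero_mul]
  split_ifs with hk
  · obtain ⟨n, rfl⟩ : ∃ n : ℕ, k = -n := ⟨(-k).toNat, by omega⟩
    rw [← Finset.sum_filter, PowerSeries.coeff_mul, ← Finset.Nat.sum_antidiagonal_swap,
      Finset.Nat.sum_antidiagonal_eq_sum_range_succ_mk]
    refine Finset.sum_congr ?_ fun q hq => ?_
    · ext q
      simp only [Finset.mem_filter, Finset.mem_range]
      omega
    · rw [Finset.mem_range] at hq
      simp only [Prod.swap_prod_mk, PowerSeries.coeff_mk]
      congr 2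
      omega
  · exact Finset.sum_eq_zero fun q _ => if_neg (by omega)

/-! ### The bilinear expression in terms of `P⁺` and `P⁻`. -/

namespace TauFunction

variable {𝕜 : Type*} [RCLike 𝕜] [NormedAlgebra 𝕜 ℂ] {r : ℕ} {k : ℤ}

theorem smoothInTimes_foldr_twistedDeriv {D : Set (Times 𝕜 r)} (c : Fin r)
    {G : ℤ → Times 𝕜 r → ℂ} (hG : ∀ n, SmoothInTimes D (G n)) (l : List (Fin r × ℕ+)) (n : ℤ) :
    SmoothInTimes D (l.foldr (twistedDeriv c) G n) := by
  induction l generalizing n with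
  | nil => exact hG n
  | cons i l ih =>
    refine ((ih n).timeDeriv i).add ?_
    by_cases h : i.1 = c
    · simp only [h, if_true]
      exact ih _
    · simp only [h, if_false]
      exact smoothInTimes_const D 0

theorem smoothInTimes_pairCoeff (τ : TauFunction 𝕜 r k) (c : Fin r) (m' m'' : Fin r → ℤ)
    (hm' : ∑ a, m' a = k) (t'' : Times 𝕜 r) (n : ℤ) :
    SmoothInTimes τ.domain (τ.pairCoeff c m' m'' t'' n) := by
  unfold pairCoeff
  split_ifs
  · exact SmoothInTimes.sum _ fun q _ =>
      ((τ.smooth m' hm').eMinus 1 c q.1).mul (smoothInTimes_const _ _)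
  · exact smoothInTimes_const _ 0

/-- The two copies of `m` contribute an even exponent. What remains are the signs built into
`P⁺_{ac}` and `P⁻_{bc}`. -/
theorem neg_one_zpow_sum (m : Fin r → ℤ) (a b c : Fin r) :
    (-1 : ℂ) ^ (∑ d ∈ Finset.univ.filter (fun d => d < c),
        ((m + stdVec a) d + (m - stdVec b) d))
      = (if a < c then -1 else 1) * (if b < c then -1 else 1) := by
  have h : ∀ e : Fin r, ∑ d ∈ Finset.univ.filter (fun d => d < c), stdVec e d
      = if e < c then 1 else 0 := by
    intro e
    simp only [stdVec, Pi.single_apply, Finset.sum_ite_eq', Finset.mem_filter, Finset.mem_univ,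
      true_and]
  have e1 : ∑ d ∈ Finset.univ.filter (fun d => d < c), ((m + stdVec a) d + (m - stdVec b) d)
      = 2 * (∑ d ∈ Finset.univ.filter (fun d => d < c), m d) + (if a < c then 1 else 0)
        - (if b < c then 1 else 0) := by
    rw [← h a, ← h b, Finset.mul_sum, ← Finset.sum_add_distrib, ← Finset.sum_sub_distrib]
    exact Finset.sum_congr rfl fun d _ => by simp only [Pi.add_apply, Pi.sub_apply]; ring
  rw [e1, zpow_sub₀ (by norm_num), zpow_add₀ (by norm_num), zpow_mul]
  split_ifs <;> norm_num

section Expansion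

variable (τ : TauFunction 𝕜 r k)

/-- The factor `ε^n` undoes the substitution `z ↦ ±z` in the definition of `P^±`, and `X` stands for
`z⁻¹`. -/
theorem mul_PCoeff (ε : ℤˣ) (m : Fin r → ℤ) (a c : Fin r) (n : ℕ) (t : Times 𝕜 r)
    (h : τ.toFun m t ≠ 0) :
    τ.toFun m t * ((((ε : ℤ) : ℂ)) ^ n * τ.PCoeff ε m a c n t) = (if a < c then -1 else 1) *
      PowerSeries.coeff n (PowerSeries.X ^ (if a = c then 0 else 1) *
        PowerSeries.mk fun q =>
          eMinus ε c q (τ.toFun (m + (ε : ℤ) • (stdVec a - stdVec c))) t) := by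
  have hε : (((ε : ℤ) : ℂ)) ^ n * (((ε : ℤ) : ℂ)) ^ n = 1 := by
    rw [← mul_pow, ← Int.cast_mul, ← Units.val_mul, Int.units_mul_self]
    simp
  rw [PCoeff, ← mul_assoc ((((ε : ℤ) : ℂ)) ^ n), ← mul_assoc ((((ε : ℤ) : ℂ)) ^ n), hε, one_mul,
    mul_left_comm, mul_div_cancel₀ _ h, PowerSeries.coeff_X_pow_mul']
  congr 1
  by_cases hac : a = c
  · simp [hac]
  · simp only [hac, if_false, PowerSeries.coeff_mk]
    rcases n with _ | n <;> simp

/-- For `m' = m + e_a` and `m'' = m - e_b` the power `z^{m'_c - m''_c - 2}` is `z^{δ_{ac}-1}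
z^{δ_{bc}-1}`, the two prefactors of `P⁺_{ac}` and `P⁻_{bc}`. The points `x` and `y` are kept apart
because only the first is to be differentiated. -/
theorem pairCoeff_eq (m : Fin r → ℤ) (a b c : Fin r) (x y : Times 𝕜 r)
    (hx : τ.toFun m x ≠ 0) (hy : τ.toFun m y ≠ 0) (k : ℤ) (K : ℕ) (hK : 0 - k < K) :
    τ.pairCoeff c (m + stdVec a - stdVec c) (m - stdVec b + stdVec c) y
        (k + (2 - ((m + stdVec a) c - (m - stdVec b) c))) x
      = ∑ q ∈ Finset.range K,
        (PDO.ofSeries fun n => τ.toFun m x * τ.PCoeff 1 m a c n x).coeff (k + q) *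
          ((if a < c then -1 else 1) * (if b < c then -1 else 1) * τ.toFun m y *
            ((-1) ^ q * τ.PCoeff (-1) m b c q y)) := by
  have h1 := fun n => τ.mul_PCoeff 1 m a c n x hx
  have h2 := fun n => τ.mul_PCoeff (-1) m b c n y hy
  simp only [Units.val_one, Int.cast_one, one_pow, one_mul, one_smul] at h1
  simp only [Units.val_neg, Units.val_one, Int.cast_neg, Int.cast_one, neg_smul, one_smul] at h2
  rw [sum_range_ofSeries_mul _ _ k K hK]
  simp only [h1, mul_assoc, h2]
  set F : PowerSeries ℂ := PowerSeries.mk fun q =>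
    eMinus 1 c q (τ.toFun (m + (stdVec a - stdVec c))) x with hF
  set H : PowerSeries ℂ := PowerSeries.mk fun q =>
    eMinus (-1) c q (τ.toFun (m + -(stdVec b - stdVec c))) y with hH
  have key : (PowerSeries.mk fun n => (if a < c then -1 else 1) *
        PowerSeries.coeff n (PowerSeries.X ^ (if a = c then 0 else 1) * F)) *
      (PowerSeries.mk fun n => (if a < c then -1 else 1) * ((if b < c then -1 else 1) *
        ((if b < c then -1 else 1) *
          PowerSeries.coeff n (PowerSeries.X ^ (if b = c then 0 else 1) * H))))
      = PowerSeries.X ^ ((if a = c then 0 else 1) + (if b = c then 0 else 1)) * (F * H) := by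
    have e : ∀ (σ : ℂ) (A : PowerSeries ℂ),
        (PowerSeries.mk fun n => σ * PowerSeries.coeff n A) = PowerSeries.C σ * A := by
      intro σ A
      ext n
      rw [PowerSeries.coeff_mk, PowerSeries.coeff_C_mul]
    have hb : (if b < c then -1 else 1 : ℂ) * (if b < c then -1 else 1) = 1 := by
      split_ifs <;> norm_num
    have ha : (if a < c then -1 else 1 : ℂ) * (if a < c then -1 else 1) = 1 := by
      split_ifs <;> norm_num
    have hC : PowerSeries.C (if a < c then -1 else 1 : ℂ) *
        PowerSeries.C (if a < c then -1 else 1) = 1 := by rw [← map_mul, ha, map_one]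
    simp only [← mul_assoc, hb, mul_one, e]
    rw [pow_add]
    linear_combination (PowerSeries.X ^ (if a = c then 0 else 1) * F *
      PowerSeries.X ^ (if b = c then 0 else 1) * H) * hC
  rw [key, PowerSeries.coeff_X_pow_mul']
  have hs : (2 - ((m + stdVec a) c - (m - stdVec b) c) : ℤ)
      = (((if a = c then 0 else 1) + (if b = c then 0 else 1) : ℕ) : ℤ) := by
    simp only [Pi.add_apply, Pi.sub_apply, stdVec, Pi.single_apply, eq_comm (a := c)]
    split_ifs <;> simp
  rw [hs, pairCoeff]
  generalize (if a = c then 0 else 1) + (if b = c then 0 else 1) = s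
  by_cases hk : k + (s : ℤ) ≤ 0
  · rw [if_pos hk, if_pos (by omega), if_pos (by omega), PowerSeries.coeff_mul,
      show (-(k + (s : ℤ))).toNat = (-k).toNat - s by omega]
    refine Finset.sum_congr rfl fun q _ => ?_
    rw [hF, hH, PowerSeries.coeff_mk, PowerSeries.coeff_mk, add_sub_assoc,
      show m - stdVec b + stdVec c = m + -(stdVec b - stdVec c) by abel]
  · rw [if_neg hk]
    split_ifs
    · omega
    · rfl
    · rfl

end Expansion

variable [NeZero r]

/-! ### Restriction of the bilinear equations to the `x`-line. -/

section Pullback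

variable (τ : TauFunction 𝕜 r k) (p : Fin r → ℕ) (m : Fin r → ℤ) (hm : ∑ a, m a = k)
  (t : Times 𝕜 r)

/-- A smooth function of the times, as a function of `x` at the reduced and translated times. -/
def pullback (f : Times 𝕜 r → ℂ) (hf : SmoothInTimes τ.domain f) :
    smoothFun (τ.region p m hm t) :=
  ⟨fun x => f (reducedTimes p t x), fun x => f (reducedTimes p t x),
    fun x hx => (contDiffAt_reducedTimes hf p t x hx.1).contDiffWithinAt, fun _ => rfl⟩

theorem deriv_pullback (f : Times 𝕜 r → ℂ) (hf : SmoothInTimes τ.domain f) :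
    Differential.deriv (τ.pullback p m hm t f hf)
      = ∑ i ∈ shiftedTimes p, τ.pullback p m hm t (timeDeriv i f) (hf.timeDeriv i) := by
  refine Subtype.ext (funext fun u => ?_)
  rw [smoothFun.deriv_apply _ (fun x => f (reducedTimes p t x)) (fun _ => rfl),
    deriv_reducedTimes hf p t u u.2.1, smoothFun.sum_apply]
  rfl

/-- The function `τ^m` of `x`. -/
def tauFun : smoothFun (τ.region p m hm t) := τ.pullback p m hm t (τ.toFun m) (τ.smooth m hm)

theorem isUnit_tauFun : IsUnit (τ.tauFun p m hm t) := by
  refine IsUnit.of_mul_eq_one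
    ⟨fun x => (τ.toFun m (reducedTimes p t x))⁻¹, fun x => (τ.toFun m (reducedTimes p t x))⁻¹,
      fun x hx => ((contDiffAt_reducedTimes (τ.smooth m hm) p t x hx.1).inv
        hx.2).contDiffWithinAt, fun _ => rfl⟩ ?_
  exact Subtype.ext (funext fun u => mul_inv_cancel₀ u.2.2)

/-- The value `1` or `0` according to whether `c ≤ r_1` or not. -/
noncomputable def topIndicator (c : Fin r) : smoothFun (τ.region p m hm t) :=
  if p c = p 0 then 1 else 0

variable {τ} in
theorem twist_pullback (c : Fin r) {G : ℤ → Times 𝕜 r → ℂ}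
    (hG : ∀ n, SmoothInTimes τ.domain (G n)) (s : ℤ) (l : List (Fin r × ℕ+)) :
    twist (τ.topIndicator p m hm t c) (fun k => τ.pullback p m hm t
        (l.foldr (twistedDeriv c) G (k + s)) (smoothInTimes_foldr_twistedDeriv c hG l _))
      = ∑ i ∈ shiftedTimes p, fun k => τ.pullback p m hm t
        ((i :: l).foldr (twistedDeriv c) G (k + s))
        (smoothInTimes_foldr_twistedDeriv c hG (i :: l) _) := by
  funext n
  rw [twist_apply, deriv_pullback, Finset.sum_apply]
  refine Subtype.ext (funext fun u => ?_)
  rw [smoothFun.sum_apply]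
  change (∑ i ∈ shiftedTimes p, _ : smoothFun (τ.region p m hm t)).1 u + _ * _ = _
  rw [smoothFun.sum_apply]
  change _ = ∑ i ∈ shiftedTimes p,
    (timeDeriv i (l.foldr (twistedDeriv c) G (n + s)) (reducedTimes p t u) +
      if i.1 = c then l.foldr (twistedDeriv c) G (n + s - (i.2 : ℕ)) (reducedTimes p t u) else 0)
  rw [Finset.sum_add_distrib]
  congr 1
  -- At most one shifted time, `t_1^{(c)}`, has upper index `c`, and it is there exactly when `c ≤
  -- r_1`; hence the coefficient of `z` is `topIndicator`.
  rw [shiftedTimes, Finset.sum_product]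
  simp only [Finset.sum_singleton, Finset.sum_ite_eq', Finset.mem_filter, Finset.mem_univ,
    true_and, PNat.one_coe, Nat.cast_one, topIndicator]
  split_ifs
  · rw [show n + s - 1 = n - 1 + s by ring]
    exact one_mul _
  · exact zero_mul _

variable {τ} in
/-- The bilinear equations, for the derivatives with respect to `x`. -/
theorem sum_twist_pow_eq_zero (hτ : τ.IsPKdV p) (ℓ : ℕ) (m' m'' : Fin r → ℤ)
    (hm' : ∑ a, m' a = k + 1) (hm'' : ∑ a, m'' a = k - 1) (y : τ.region p m hm t)
    (hG : ∀ c n, SmoothInTimes τ.domain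
      (τ.pairCoeff c (m' - stdVec c) (m'' + stdVec c) (reducedTimes p t y) n))
    (N : ℕ) (l : List (Fin r × ℕ+)) :
    ∑ c : Fin r, (-1 : ℂ) ^ (∑ b ∈ Finset.univ.filter (fun b => b < c), (m' b + m'' b)) *
      ((twist (τ.topIndicator p m hm t c) ^ N) (fun k => τ.pullback p m hm t
        (l.foldr (twistedDeriv c)
          (τ.pairCoeff c (m' - stdVec c) (m'' + stdVec c) (reducedTimes p t y))
          (k + (2 - (m' c - m'' c))))
        (smoothInTimes_foldr_twistedDeriv c (hG c) l _)) (-1 - ℓ * p c)).1 y = 0 := by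
  -- Each derivative in `x` is a sum of time derivatives, which are absorbed into the list `l`.
  induction N generalizing l with
  | zero =>
    rw [← hτ ℓ m' m'' hm' hm'' l (reducedTimes p t y) y.2.1]
    refine Finset.sum_congr rfl fun c _ => ?_
    rw [show -1 - (m' c - m'' c + ℓ * p c - 2) = -1 - (ℓ : ℤ) * p c + (2 - (m' c - m'' c)) by ring]
    rfl
  | succ N ih =>
    simp only [twist_pow_succ_apply, twist_pullback p m hm t _ (hG _), map_sum, Finset.sum_apply,
      smoothFun.sum_apply, Finset.mul_sum]
    rw [Finset.sum_comm]
    exact Finset.sum_eq_zero fun i _ => ih (i :: l)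

end Pullback

/-! ### The bilinear equations as residue identities. -/

section Bilinear

variable (τ : TauFunction 𝕜 r k) (p : Fin r → ℕ) (m : Fin r → ℤ) (hm : ∑ a, m a = k)
  (t : Times 𝕜 r)

/-- The coefficient of `z⁻ⁿ` in `Q⁻_{ab}(m, x, t, -z)`. -/
noncomputable def Qneg (a b : Fin r) (n : ℕ) : smoothFun (τ.region p m hm t) :=
  (-1) ^ n * τ.Q p m hm t (-1) a b n

variable {τ} in
/-- The bilinear equations in terms of `Q⁺` and `Q⁻`. -/
theorem sum_twist_pow_Q_eq_zero (hτ : τ.IsPKdV p) (ℓ : ℕ) (a b : Fin r) (N K : ℕ)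
    (hK : ∀ c, N + 1 + ℓ * p c < K) :
    ∑ c : Fin r, ∑ q ∈ Finset.range K,
      (twist (τ.topIndicator p m hm t c) ^ N)
        (PDO.C (τ.tauFun p m hm t) * PDO.ofSeries fun n => τ.Q p m hm t 1 a c n).coeff
          (-1 - ℓ * p c + q) * τ.Qneg p m hm t b c q = 0 := by
  refine Subtype.ext (funext fun y => ?_)
  have hsum : ∀ v : Fin r, ∑ d, stdVec v d = 1 := fun v => by simp [stdVec]
  have hm' : ∑ d, (m + stdVec a) d = k + 1 := by
    simp only [Pi.add_apply, Finset.sum_add_distrib, hm, hsum]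
  have hm'' : ∑ d, (m - stdVec b) d = k - 1 := by
    simp only [Pi.sub_apply, Finset.sum_sub_distrib, hm, hsum]
  have hG : ∀ c n, SmoothInTimes τ.domain (τ.pairCoeff c (m + stdVec a - stdVec c)
      (m - stdVec b + stdVec c) (reducedTimes p t y) n) := fun c n =>
    τ.smoothInTimes_pairCoeff c _ _ (by
      simp only [Pi.sub_apply, Finset.sum_sub_distrib, hm', hsum]; ring) _ n
  have H := sum_twist_pow_eq_zero p m hm t hτ ℓ (m + stdVec a) (m - stdVec b) hm' hm'' y hG N []
  have hterm : ∀ c : Fin r,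
      (-1 : ℂ) ^ (∑ d ∈ Finset.univ.filter (fun d => d < c),
        ((m + stdVec a) d + (m - stdVec b) d)) *
      ((twist (τ.topIndicator p m hm t c) ^ N) (fun k => τ.pullback p m hm t
        (([] : List (Fin r × ℕ+)).foldr (twistedDeriv c)
          (τ.pairCoeff c (m + stdVec a - stdVec c) (m - stdVec b + stdVec c)
            (reducedTimes p t y))
          (k + (2 - ((m + stdVec a) c - (m - stdVec b) c))))
        (smoothInTimes_foldr_twistedDeriv c (hG c) [] _)) (-1 - ℓ * p c)).1 y
      = τ.toFun m (reducedTimes p t y) * (∑ q ∈ Finset.range K,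
      (twist (τ.topIndicator p m hm t c) ^ N)
        (PDO.C (τ.tauFun p m hm t) * PDO.ofSeries fun n => τ.Q p m hm t 1 a c n).coeff
          (-1 - ℓ * p c + q) * τ.Qneg p m hm t b c q).1 y := by
    intro c
    set σ : ℂ := (if a < c then -1 else 1) * (if b < c then -1 else 1) with hσ
    have hσ2 : σ * σ = 1 := by
      rw [hσ]
      split_ifs <;> norm_num
    -- The second argument is frozen at `y`, so its coefficients are constants in `x` and the
    -- convolution commutes with the twist. Evaluation at `y` comes only afterwards.
    rw [neg_one_zpow_sum, twist_pow_conv (τ.topIndicator p m hm t c)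
      (h := fun q => algebraMap ℂ _ (σ * τ.toFun m (reducedTimes p t y) *
        ((-1) ^ q * τ.PCoeff (-1) m b c q (reducedTimes p t y))))
      (fun q => smoothFun.deriv_algebraMap _) N (M := 0)
      (F := (PDO.C (τ.tauFun p m hm t) * PDO.ofSeries fun n => τ.Q p m hm t 1 a c n).coeff)
      ?_ _ K (by
        have : (N : ℤ) + 1 + ℓ * p c < K := by exact_mod_cast hK c
        linarith)]
    · rw [smoothFun.sum_apply, smoothFun.sum_apply, Finset.mul_sum, Finset.mul_sum]
      refine Finset.sum_congr rfl fun q _ => ?_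
      generalize (twist (τ.topIndicator p m hm t c) ^ N)
        (PDO.C (τ.tauFun p m hm t) * PDO.ofSeries fun n => τ.Q p m hm t 1 a c n).coeff
          (-1 - ℓ * p c + q) = A
      change σ * (A.1 y * (σ * τ.toFun m (reducedTimes p t y) *
        ((-1) ^ q * τ.PCoeff (-1) m b c q (reducedTimes p t y)))) =
        τ.toFun m (reducedTimes p t y) * (A.1 y *
          ((-1) ^ q * τ.PCoeff (-1) m b c q (reducedTimes p t y)))
      linear_combination (A.1 y * τ.toFun m (reducedTimes p t y) *
        ((-1) ^ q * τ.PCoeff (-1) m b c q (reducedTimes p t y))) * hσ2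
    · intro n K hK
      refine Subtype.ext (funext fun x => ?_)
      refine (τ.pairCoeff_eq m a b c (reducedTimes p t x) (reducedTimes p t y) x.2.2 y.2.2 n K
        hK).trans ?_
      rw [smoothFun.sum_apply]
      refine Finset.sum_congr rfl fun q _ => ?_
      change _ = ((PDO.C (τ.tauFun p m hm t) *
        PDO.ofSeries fun n => τ.Q p m hm t 1 a c n).coeff (n + q)).1 x * _
      congr 1
      rw [PDO.coeff_C_mul, PDO.coeff_ofSeries, PDO.coeff_ofSeries]
      split_ifs
      · rfl
      · exact (mul_zero _).symm
  rw [Finset.sum_congr rfl fun c _ => hterm c, ← Finset.mul_sum] at H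
  rw [smoothFun.sum_apply]
  exact (mul_eq_zero.1 H).resolve_left y.2.2

end Bilinear

end TauFunction

theorem PDO.eq_zero_of_isDifferential_of_orderLE {R : Type*} [CommRing R] {a : PDO R}
    (h : a.IsDifferential) (h' : a.OrderLE (-1)) : a = 0 := by
  ext n
  by_cases hn : n < 0
  · exact h n hn
  · exact h' n (by omega)

theorem PDO.monomial_sum {R ι : Type*} [CommRing R] (n : ℤ) (s : Finset ι) (f : ι → R) :
    PDO.monomial n (∑ i ∈ s, f i) = ∑ i ∈ s, PDO.monomial n (f i) := by
  ext k
  simp only [PDO.coeff_sum, PDO.coeff_monomial]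
  split_ifs <;> simp

theorem Matrix.single_pow_self {n α : Type*} [Fintype n] [DecidableEq n] [Semiring α] (i : n)
    (x : α) {k : ℕ} (hk : k ≠ 0) : Matrix.single i i x ^ k = Matrix.single i i (x ^ k) := by
  obtain ⟨k, rfl⟩ := Nat.exists_eq_succ_of_ne_zero hk
  induction k with
  | zero => simp
  | succ k ih =>
    rw [pow_succ, ih (by omega), Matrix.single_mul_single_same, ← pow_succ]

/-! ### The inverse of `Q⁺₁₁` and the negative part of `L̃`. -/

namespace TauFunction

variable {𝕜 : Type*} [RCLike 𝕜] [NormedAlgebra 𝕜 ℂ] {r : ℕ} {k : ℤ} [NeZero r]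

variable (τ : TauFunction 𝕜 r k) (p : Fin r → ℕ) (m : Fin r → ℤ) (hm : ∑ a, m a = k)
  (t : Times 𝕜 r)

theorem Q_zero (ε : ℤˣ) (a b : Fin r) :
    τ.Q p m hm t ε a b 0 = if a = b then 1 else 0 := by
  refine Subtype.ext (funext fun x => ?_)
  change τ.PCoeff ε m a b 0 (reducedTimes p t x) = _
  have h0 : ∀ f : Times 𝕜 r → ℂ, _root_.eMinus ε b 0 f (reducedTimes p t x)
      = f (reducedTimes p t x) := by
    intro f
    have : Subsingleton (Composition 0) := ⟨fun c d => Composition.ext (by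
      rw [c.blocks_eq_nil.2 rfl, d.blocks_eq_nil.2 rfl])⟩
    rw [_root_.eMinus, Fintype.sum_eq_single (default : Composition 0)
      fun c hc => absurd (Subsingleton.elim c default) hc]
    have hb : (default : Composition 0).blocks = [] := by
      rw [Composition.blocks_eq_nil]
    simp [Composition.length, hb]
  by_cases h : a = b
  · subst h
    simp only [PCoeff, if_true, h0, sub_self, smul_zero, add_zero, lt_irrefl, if_false, pow_zero,
      one_mul, div_self x.2.2]
    rfl
  · simp [PCoeff, h]

theorem Qneg_zero (a b : Fin r) : τ.Qneg p m hm t a b 0 = if a = b then 1 else 0 := by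
  rw [Qneg, pow_zero, one_mul, Q_zero]

/-- The formal adjoint of `Q⁻₁₁(∂)`. -/
noncomputable def Q11Adj : Matrix (Top p) (Top p) (PDO (smoothFun (τ.region p m hm t))) :=
  Matrix.of fun c b => PDO.coadj fun n => τ.Qneg p m hm t b c n

/-- The negative part of `Q⁺₁₁(∂) ∘ ∂^{ℓ p_1} ∘ Q⁻₁₁(∂)^*`, up to sign. -/
noncomputable def restTerm (ℓ : ℕ) (a b : Fin r) : PDO (smoothFun (τ.region p m hm t)) :=
  ∑ c : Rest p, ∑ q ∈ Finset.HasAntidiagonal.antidiagonal (ℓ * p c + 1),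
    PDO.C (τ.Q p m hm t 1 a c q.1) * PDO.monomial (-1) 1 * PDO.C (τ.Qneg p m hm t b c q.2)

variable {τ} in
-- This contains all that is used of the bilinear equations: the identity with `N` derivatives in
-- `x` says that `∂^N ∘ τE` has no residue, where `E` is the operator in question.
theorem isDifferential_add_restTerm (hτ : τ.IsPKdV p) (ℓ : ℕ) (a b : Fin r) :
    (∑ c : Top p, (PDO.ofSeries fun n => τ.Q p m hm t 1 a c n) *
        PDO.monomial (ℓ * p 0 : ℤ) 1 * (PDO.coadj fun n => τ.Qneg p m hm t b c n) +
      τ.restTerm p m hm t ℓ a b).IsDifferential := by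
  obtain ⟨v, hv⟩ := (τ.isUnit_tauFun p m hm t).exists_left_inv
  set T := τ.tauFun p m hm t with hT
  set E := ∑ c : Top p, (PDO.ofSeries fun n => τ.Q p m hm t 1 a c n) *
        PDO.monomial (ℓ * p 0 : ℤ) 1 * (PDO.coadj fun n => τ.Qneg p m hm t b c n) +
      τ.restTerm p m hm t ℓ a b with hE
  -- The factor `τ^m(t')` is differentiated along with `Q⁺`, so it stays inside the residue and is
  -- removed only at the end, being a unit.
  suffices h : (PDO.C T * E).IsDifferential by
    have := (PDO.isDifferential_C v).mul h
    rwa [← mul_assoc, ← map_mul, hv, map_one, one_mul] at this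
  refine PDO.isDifferential_of_residue _ fun N => ?_
  obtain ⟨K, hK⟩ : ∃ K : ℕ, ∀ c, N + 1 + ℓ * p c < K := by
    obtain ⟨B, hB⟩ := (Set.finite_range p).bddAbove
    refine ⟨N + 1 + ℓ * B + 1, fun c => ?_⟩
    have := Nat.mul_le_mul_left ℓ (hB ⟨c, rfl⟩)
    omega
  rw [← sum_twist_pow_Q_eq_zero p m hm t hτ ℓ a b N K hK,
    ← Fintype.sum_subtype_add_sum_subtype (fun c => p c = p 0), hE, restTerm, mul_add, mul_add,
    PDO.coeff_add]
  congr 1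
  · rw [Finset.mul_sum, Finset.mul_sum, PDO.coeff_sum]
    refine Finset.sum_congr rfl fun c _ => ?_
    have ho : (PDO.monomial 1 1 ^ N *
        (PDO.C T * PDO.ofSeries fun n => τ.Q p m hm t 1 a c n)).OrderLE N := by
      rw [PDO.monomial_one_pow]
      simpa using (PDO.orderLE_monomial (1 * N : ℤ) 1).mul
        ((PDO.orderLE_C T).mul (PDO.orderLE_ofSeries fun n => τ.Q p m hm t 1 a c n))
    rw [← mul_assoc (PDO.C T), ← mul_assoc (PDO.C T), ← mul_assoc, ← mul_assoc,
      PDO.residue_mul_coadj ho _ _ K, topIndicator, if_pos c.2, twist_one_pow_coeff, c.2]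
    have := hK 0
    zify at this
    linarith
  · rw [Finset.mul_sum, Finset.mul_sum, PDO.coeff_sum]
    refine Finset.sum_congr rfl fun c _ => ?_
    rw [Finset.mul_sum, Finset.mul_sum, PDO.coeff_sum, topIndicator, if_neg c.2]
    simp only [twist_zero_pow_apply]
    -- For `c > r_1` the twist is plain differentiation and acts on each coefficient separately.
    have e1 : ∀ n : ℤ, Differential.deriv^[N]
        ((PDO.C T * PDO.ofSeries fun n => τ.Q p m hm t 1 a c n).coeff n)
        = (PDO.ofSeries fun n => Differential.deriv^[N] (T * τ.Q p m hm t 1 a c n)).coeff n := by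
      intro n
      rw [PDO.coeff_C_mul, PDO.coeff_ofSeries, PDO.coeff_ofSeries]
      split_ifs
      · rfl
      · rw [mul_zero, PDO.iter_zero]
    simp only [← hT, e1]
    have hKc : (N : ℤ) + 1 + ℓ * p c < K := by exact_mod_cast hK c
    have hpc : (0 : ℤ) ≤ ℓ * p c := by positivity
    rw [sum_range_ofSeries_mul _ _ _ K (by linarith), if_pos (by linarith), PowerSeries.coeff_mul,
      show (-(-1 - (ℓ : ℤ) * p c)).toNat = ℓ * p c + 1 by
        rw [← Nat.cast_mul]; omega]
    refine Finset.sum_congr rfl fun q _ => ?_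
    rw [PowerSeries.coeff_mk, PowerSeries.coeff_mk, ← mul_assoc (PDO.C T),
      ← mul_assoc (PDO.C T), ← map_mul, PDO.residue_D_pow_mul]

theorem orderLE_Q11_sub_one (i j : Top p) : ((τ.Q11 p m hm t - 1) i j).OrderLE (-1) := by
  rw [Matrix.sub_apply, Q11, Matrix.of_apply]
  obtain rfl | h := eq_or_ne i j
  · rw [Matrix.one_apply_eq]
    exact PDO.orderLE_ofSeries_sub_one (by rw [Q_zero, if_pos rfl])
  · rw [Matrix.one_apply_ne h, sub_zero]
    exact PDO.orderLE_ofSeries_neg_one (by rw [Q_zero, if_neg (Subtype.coe_ne_coe.2 h)])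

theorem orderLE_Q11Adj_sub_one (i j : Top p) :
    ((τ.Q11Adj p m hm t - 1) i j).OrderLE (-1) := by
  rw [Matrix.sub_apply, Q11Adj, Matrix.of_apply]
  have := PDO.orderLE_coadj_sub_C fun n => τ.Qneg p m hm t j i n
  rw [Qneg_zero] at this
  obtain rfl | h := eq_or_ne i j
  · rw [Matrix.one_apply_eq]
    rwa [if_pos rfl, map_one] at this
  · rw [Matrix.one_apply_ne h]
    rwa [if_neg (Subtype.coe_ne_coe.2 h.symm), map_zero] at this

theorem orderLE_Q11Adj (i j : Top p) : (τ.Q11Adj p m hm t i j).OrderLE 0 :=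
  PDO.orderLE_coadj _

/-- For `ℓ = 0` the indices add up to `1`, so one of them is `0`, and the leading coefficients
`δ_{ac}`, `δ_{bc}` vanish because `a, b ≤ r_1 < c`. -/
theorem restTerm_zero (a b : Top p) : τ.restTerm p m hm t 0 a b = 0 := by
  refine Finset.sum_eq_zero fun c _ => Finset.sum_eq_zero fun q hq => ?_
  have ha : (a : Fin r) ≠ c := fun h => c.2 (h ▸ a.2)
  have hb : (b : Fin r) ≠ c := fun h => c.2 (h ▸ b.2)
  rw [Finset.HasAntidiagonal.mem_antidiagonal, zero_mul, zero_add] at hq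
  obtain ⟨h1, h2⟩ | ⟨h1, h2⟩ : (q.1 = 0 ∧ q.2 = 1) ∨ (q.1 = 1 ∧ q.2 = 0) := by omega
  · rw [h1, Q_zero, if_neg ha, map_zero, zero_mul, zero_mul]
  · rw [h2, Qneg_zero, if_neg hb, map_zero, mul_zero]

variable {τ} in
-- The case `ℓ = 0`: both factors are `1` plus negative order, while the difference of their product
-- and `1` is differential, hence zero.
theorem Q11_mul_Q11Adj (hτ : τ.IsPKdV p) : τ.Q11 p m hm t * τ.Q11Adj p m hm t = 1 := by
  rw [← sub_eq_zero]
  ext1 a b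
  rw [Matrix.zero_apply]
  refine PDO.eq_zero_of_isDifferential_of_orderLE ?_ ?_
  · rw [Matrix.sub_apply]
    refine PDO.IsDifferential.sub ?_ ?_
    · have := isDifferential_add_restTerm p m hm t hτ 0 a b
      rw [restTerm_zero, add_zero] at this
      rw [Matrix.mul_apply]
      simp only [Nat.cast_zero, zero_mul, PDO.monomial_zero_one, mul_one] at this
      exact this
    · rw [Matrix.one_apply]
      split_ifs
      · exact PDO.isDifferential_one
      · exact PDO.isDifferential_zero
  · rw [show τ.Q11 p m hm t * τ.Q11Adj p m hm t - 1
      = (τ.Q11 p m hm t - 1) * τ.Q11Adj p m hm t + (τ.Q11Adj p m hm t - 1) by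
        rw [sub_mul, one_mul]; abel, Matrix.add_apply]
    refine PDO.OrderLE.add ?_ (τ.orderLE_Q11Adj_sub_one p m hm t a b)
    simpa using PDO.matrix_orderLE_mul (τ.orderLE_Q11_sub_one p m hm t)
      (τ.orderLE_Q11Adj p m hm t) a b

variable {τ} in
theorem Q11Adj_mul_Q11 (hτ : τ.IsPKdV p) : τ.Q11Adj p m hm t * τ.Q11 p m hm t = 1 :=
  PDO.matrix_mul_eq_one_symm (τ.orderLE_Q11_sub_one p m hm t) (Q11_mul_Q11Adj p m hm t hτ)

variable {τ} in
-- Powers commute with conjugation, `(E_{aa}∂)^{p_1} = E_{aa}∂^{p_1}` because `p_1 ≠ 0`, and the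
-- `E_{aa}` sum to the identity.
theorem laxTilde_eq (hτ : τ.IsPKdV p) (hp : p 0 ≠ 0) :
    τ.laxTilde p m hm t
      = τ.Q11 p m hm t * τ.leadingTerm p m hm t * τ.Q11Adj p m hm t := by
  let u : (Matrix (Top p) (Top p) (PDO (smoothFun (τ.region p m hm t))))ˣ :=
    ⟨τ.Q11 p m hm t, τ.Q11Adj p m hm t, Q11_mul_Q11Adj p m hm t hτ, Q11Adj_mul_Q11 p m hm t hτ⟩
  have hu : Ring.inverse (τ.Q11 p m hm t) = τ.Q11Adj p m hm t := Ring.inverse_unit u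
  have hpow : ∀ a : Top p, τ.lax p m hm t a ^ p 0 = τ.Q11 p m hm t *
      Matrix.single a a (PDO.monomial (p 0 : ℤ) 1) * τ.Q11Adj p m hm t := by
    intro a
    rw [lax, hu]
    have := u.conj_pow (Matrix.single a a (PDO.monomial 1 1)) (p 0)
    rw [Matrix.single_pow_self _ _ hp, PDO.monomial_one_pow, one_mul] at this
    exact this
  rw [laxTilde, Finset.sum_congr rfl fun a _ => hpow a, ← Finset.sum_mul, ← Finset.mul_sum]
  congr 2
  ext1 i j
  rw [Matrix.sum_apply, leadingTerm, Matrix.diagonal_apply]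
  split_ifs with h
  · subst h
    rw [Finset.sum_eq_single i]
    · simp
    · intro c _ hc; simp [hc]
    · simp
  · refine Finset.sum_eq_zero fun c _ => ?_
    rw [Matrix.single_apply, if_neg]
    rintro ⟨rfl, rfl⟩
    exact h rfl

variable {τ} in
theorem isDifferential_laxTilde_add (hτ : τ.IsPKdV p) (hp : p 0 ≠ 0) (a b : Top p) :
    (τ.laxTilde p m hm t a b + τ.restTerm p m hm t 1 a b).IsDifferential := by
  have := isDifferential_add_restTerm p m hm t hτ 1 a b
  rw [laxTilde_eq p m hm t hτ hp, Matrix.mul_apply]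
  simp only [leadingTerm, Matrix.mul_diagonal]
  rw [Nat.cast_one, one_mul] at this
  exact this

variable {τ} in
-- Conjugation by an operator of the form `1` plus negative order does not change the leading term.
theorem orderLE_laxTilde_sub (hτ : τ.IsPKdV p) (hp : p 0 ≠ 0) (a b : Top p) :
    ((τ.laxTilde p m hm t - τ.leadingTerm p m hm t) a b).OrderLE (p 0 - 1) := by
  have hL : ∀ i j, (τ.leadingTerm p m hm t i j).OrderLE (p 0) := by
    intro i j
    rw [leadingTerm, Matrix.diagonal_apply]
    split_ifs
    · exact PDO.orderLE_monomial _ _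
    · exact PDO.orderLE_zero _
  rw [laxTilde_eq p m hm t hτ hp,
    show τ.Q11 p m hm t * τ.leadingTerm p m hm t * τ.Q11Adj p m hm t - τ.leadingTerm p m hm t
      = (τ.Q11 p m hm t - 1) * τ.leadingTerm p m hm t * τ.Q11Adj p m hm t
        + τ.leadingTerm p m hm t * (τ.Q11Adj p m hm t - 1) by
      rw [sub_mul, sub_mul, mul_sub, one_mul, mul_one]; abel, Matrix.add_apply]
  refine PDO.OrderLE.add ?_ ?_
  · exact (PDO.matrix_orderLE_mul (PDO.matrix_orderLE_mul (τ.orderLE_Q11_sub_one p m hm t) hL)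
      (τ.orderLE_Q11Adj p m hm t) a b).mono (by omega)
  · exact (PDO.matrix_orderLE_mul hL (τ.orderLE_Q11Adj_sub_one p m hm t) a b).mono (by omega)

end TauFunction

/-! ### The series `exp(xz)`. -/

namespace smoothFun

variable {𝕜 : Type*} [RCLike 𝕜] [NormedAlgebra 𝕜 ℂ] (U : TopologicalSpace.Opens 𝕜)

/-- The series `exp(x z)`. -/
noncomputable def expSeries : PowerSeries (smoothFun U) :=
  PowerSeries.mk fun i => ((i.factorial : ℂ)⁻¹) • X U ^ i

theorem deriv_coeff_zero_expSeries :
    Differential.deriv (PowerSeries.coeff 0 (expSeries U)) = 0 := by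
  simp [expSeries]

theorem deriv_coeff_succ_expSeries (n : ℕ) :
    Differential.deriv (PowerSeries.coeff (n + 1) (expSeries U))
      = PowerSeries.coeff n (expSeries U) := by
  rw [expSeries, PowerSeries.coeff_mk, PowerSeries.coeff_mk, deriv_smul, Derivation.leibniz_pow,
    deriv_X, Nat.add_sub_cancel, smul_eq_mul, mul_one, ← Nat.cast_smul_eq_nsmul ℂ, smul_smul]
  congr 1
  rw [Nat.factorial_succ]
  have : (n.factorial : ℂ) ≠ 0 := Nat.cast_ne_zero.2 n.factorial_ne_zero
  have : ((n + 1 : ℕ) : ℂ) ≠ 0 := Nat.cast_ne_zero.2 n.succ_ne_zero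
  push_cast at *
  field_simp

/-- The binomial theorem for `(x - x)^n`. -/
theorem expSeries_mul :
    expSeries U * (PowerSeries.mk fun i => ((i.factorial : ℂ)⁻¹) • (-X U) ^ i) = 1 := by
  ext1 n
  rw [PowerSeries.coeff_mul, PowerSeries.coeff_one]
  have h := (Commute.all (X U) (-X U)).add_pow' n
  rw [add_neg_cancel] at h
  trans ((n.factorial : ℂ)⁻¹) • (0 : smoothFun U) ^ n
  · rw [h, Finset.smul_sum]
    refine Finset.sum_congr rfl fun q hq => ?_
    rw [Finset.HasAntidiagonal.mem_antidiagonal] at hq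
    rw [expSeries, PowerSeries.coeff_mk, PowerSeries.coeff_mk, smul_mul_smul_comm,
      ← Nat.cast_smul_eq_nsmul ℂ, smul_smul]
    congr 1
    subst hq
    rw [Nat.cast_add_choose]
    have : (((q.1 + q.2).factorial : ℕ) : ℂ) ≠ 0 :=
      Nat.cast_ne_zero.2 (Nat.factorial_ne_zero _)
    have : (q.1.factorial : ℂ) ≠ 0 := Nat.cast_ne_zero.2 (Nat.factorial_ne_zero _)
    have : (q.2.factorial : ℂ) ≠ 0 := Nat.cast_ne_zero.2 (Nat.factorial_ne_zero _)
    field_simp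
  · rcases n with _ | n <;> simp

end smoothFun

/-! ### The operators `W̃₁₂` and `W̃₂₁`. -/

namespace TauFunction

variable {𝕜 : Type*} [RCLike 𝕜] [NormedAlgebra 𝕜 ℂ] {r : ℕ} {k : ℤ} [NeZero r]

variable (τ : TauFunction 𝕜 r k) (p : Fin r → ℕ) (m : Fin r → ℤ) (hm : ∑ a, m a = k)
  (t : Times 𝕜 r)

theorem W12_apply (a : Top p) (c : Rest p) :
    τ.W12 p m hm t a c = ∑ j ∈ Finset.range (p c), PDO.monomial j (PowerSeries.coeff j
      ((PowerSeries.mk fun i => τ.expCoeff p m hm t i) *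
        PowerSeries.mk fun n => τ.Q p m hm t 1 a c (n + 1))) := by
  rw [W12, Matrix.of_apply]
  refine Finset.sum_congr rfl fun j _ => ?_
  rw [PowerSeries.coeff_mul, Finset.Nat.sum_antidiagonal_eq_sum_range_succ_mk, PDO.monomial_sum]
  simp only [PowerSeries.coeff_mk]

/-- The signs from `(-∂)^j`, from `(-x)^i` and in front combine to `(-1)^{j-i+1}`. This turns
`Q⁻_{bc}(z)` into `Q⁻_{bc}(-z)` and `exp(-xz)` into `exp(xz)`, the inverse of the factor in `W̃₁₂`.
-/
theorem W21_apply (c : Rest p) (b : Top p) :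
    τ.W21 p m hm t c b = ∑ j ∈ Finset.range (p c), PDO.monomial (j : ℤ) 1 *
      PDO.C (PowerSeries.coeff j (smoothFun.expSeries _ *
        PowerSeries.mk fun n => τ.Qneg p m hm t b c (n + 1))) := by
  rw [W21, Matrix.of_apply, ← Finset.sum_neg_distrib]
  refine Finset.sum_congr rfl fun j _ => ?_
  rw [PowerSeries.coeff_mul, Finset.Nat.sum_antidiagonal_eq_sum_range_succ_mk, map_sum,
    Finset.mul_sum, ← Finset.sum_neg_distrib]
  refine Finset.sum_congr rfl fun i hi => ?_
  rw [Finset.mem_range] at hi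
  have hpow : (-PDO.monomial 1 1 : PDO (smoothFun (τ.region p m hm t))) ^ j
      = PDO.monomial (j : ℤ) 1 * PDO.C ((-1) ^ j) := by
    rw [neg_pow, PDO.monomial_one_pow, one_mul, map_pow, map_neg, map_one]
    exact ((Commute.one_left _).neg_left.pow_left j).eq
  rw [hpow, ← PDO.C_apply, mul_assoc, ← map_mul, ← mul_neg, ← map_neg]
  congr 2
  have hneg : (-smoothFun.X (τ.region p m hm t)) ^ i
      = (-1) ^ i * smoothFun.X (τ.region p m hm t) ^ i :=
    Subtype.ext (neg_pow _ _)
  rw [smoothFun.expSeries, PowerSeries.coeff_mk, PowerSeries.coeff_mk, Qneg, expCoeff, hneg,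
    smul_mul_assoc, mul_smul_comm, mul_smul_comm, ← smul_neg]
  congr 1
  obtain ⟨d, rfl⟩ := Nat.exists_eq_add_of_le (Nat.lt_succ_iff.1 hi)
  rw [Nat.add_sub_cancel_left, pow_add, pow_succ]
  have h : ((-1 : smoothFun (τ.region p m hm t)) ^ i) * (-1) ^ i = 1 := by
    refine Subtype.ext ?_
    change (-1 : τ.region p m hm t → ℂ) ^ i * (-1) ^ i = 1
    rw [← mul_pow, neg_mul_neg, one_mul, one_pow]
  linear_combination (-(-1) ^ d * τ.Q p m hm t (-1) b c (d + 1) * smoothFun.X _ ^ i) * h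

/-- The sandwich lemma with `s = p_c - 1`, where `u` and `v` are the series of `Q⁺_{ac}` and
`Q⁻_{bc}(-z)` shifted by one. The shifts account for the total index `p_c + 1` in `restTerm`, whose
two extreme terms contain a vanishing leading coefficient. -/
theorem isDifferential_W12_mul_sub (hpos : ∀ a, 0 < p a) (a b : Top p) :
    ((τ.W12 p m hm t * τ.middle p m hm t * τ.W21 p m hm t) a b
      - τ.restTerm p m hm t 1 a b).IsDifferential := by
  rw [Matrix.mul_apply, restTerm, ← Finset.sum_sub_distrib]
  refine PDO.isDifferential_sum _ _ fun c _ => ?_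
  obtain ⟨s, hs⟩ : ∃ s, p c = s + 1 := Nat.exists_eq_succ_of_ne_zero (hpos c).ne'
  have ha : (a : Fin r) ≠ c := fun h => c.2 (h ▸ a.2)
  have hb : (b : Fin r) ≠ c := fun h => c.2 (h ▸ b.2)
  have key := PDO.isDifferential_sandwich (smoothFun.expSeries (τ.region p m hm t))
    (PowerSeries.mk fun i => τ.expCoeff p m hm t i)
    (PowerSeries.mk fun n => τ.Q p m hm t 1 a c (n + 1))
    (PowerSeries.mk fun n => τ.Qneg p m hm t b c (n + 1))
    (smoothFun.deriv_coeff_zero_expSeries _) (smoothFun.deriv_coeff_succ_expSeries _)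
    (smoothFun.expSeries_mul _) s
  rw [middle, Matrix.mul_diagonal, W12_apply, W21_apply, hs, one_mul,
    Finset.Nat.sum_antidiagonal_succ, Finset.Nat.sum_antidiagonal_succ', Q_zero, if_neg ha,
    Qneg_zero, if_neg hb]
  simpa using key

theorem isDifferential_W12 (a : Top p) (c : Rest p) : (τ.W12 p m hm t a c).IsDifferential := by
  rw [W12_apply]
  exact PDO.isDifferential_sum _ _ fun j _ => PDO.isDifferential_monomial (by omega) _

theorem orderLE_W12 (a : Top p) (c : Rest p) : (τ.W12 p m hm t a c).OrderLE (p c - 1) := by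
  rw [W12_apply]
  refine PDO.orderLE_sum _ _ _ fun j hj => (PDO.orderLE_monomial _ _).mono ?_
  rw [Finset.mem_range] at hj
  omega

theorem isDifferential_W21 (c : Rest p) (b : Top p) : (τ.W21 p m hm t c b).IsDifferential := by
  rw [W21_apply]
  exact PDO.isDifferential_sum _ _ fun j _ =>
    (PDO.isDifferential_monomial (by omega) _).mul (PDO.isDifferential_C _)

theorem orderLE_W21 (c : Rest p) (b : Top p) : (τ.W21 p m hm t c b).OrderLE (p c - 1) := by
  rw [W21_apply]
  refine PDO.orderLE_sum _ _ _ fun j hj =>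
    ((PDO.orderLE_monomial _ _).mul (PDO.orderLE_C _)).mono ?_
  rw [Finset.mem_range] at hj
  omega

/-- The summand for `c` has order at most `(p_c - 1) - p_c + (p_c - 1) = p_c - 2`. -/
theorem orderLE_W12_mul (hle : ∀ c, p c ≤ p 0) (a b : Top p) :
    ((τ.W12 p m hm t * τ.middle p m hm t * τ.W21 p m hm t) a b).OrderLE (p 0 - 1) := by
  rw [Matrix.mul_apply]
  refine PDO.orderLE_sum _ _ _ fun c _ => ?_
  rw [middle, Matrix.mul_diagonal]
  have := hle c
  exact (((τ.orderLE_W12 p m hm t a c).mul (PDO.orderLE_monomial _ _)).mul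
    (τ.orderLE_W21 p m hm t c b)).mono (by omega)

theorem isDifferential_leadingTerm (a b : Top p) :
    (τ.leadingTerm p m hm t a b).IsDifferential := by
  rw [leadingTerm, Matrix.diagonal_apply]
  split_ifs
  · exact PDO.isDifferential_monomial (by omega) _
  · exact PDO.isDifferential_zero

end TauFunction

/-! ### The decomposition of `L̃`. -/

theorem mainTheorem5 {𝕜 : Type*} [RCLike 𝕜] [NormedAlgebra 𝕜 ℂ] {r : ℕ} [NeZero r]
    (p : Fin r → ℕ) (hanti : Antitone p) (hpos : ∀ a, 0 < p a) (hp : 1 < p 0)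
    {k : ℤ} (τ : TauFunction 𝕜 r k) (hτ : τ.IsPKdV p)
    (m : Fin r → ℤ) (hm : ∑ a, m a = k) (t : Times 𝕜 r) :
    IsUnit (τ.Q11 p m hm t) ∧
    τ.laxTilde p m hm t =
      τ.leadingTerm p m hm t + τ.W11 p m hm t -
        τ.W12 p m hm t * τ.middle p m hm t * τ.W21 p m hm t ∧
    (∀ a b, (τ.W12 p m hm t a b).IsDifferential ∧
      (τ.W12 p m hm t a b).OrderLE (min (p a : ℤ) (p b : ℤ) - 1)) ∧
    (∀ a b, (τ.W21 p m hm t a b).IsDifferential ∧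
      (τ.W21 p m hm t a b).OrderLE (min (p a : ℤ) (p b : ℤ) - 1)) ∧
    (∀ a b, (τ.W11 p m hm t a b).IsDifferential ∧
      (τ.W11 p m hm t a b).OrderLE ((p 0 : ℤ) - 1)) := by
  have hle : ∀ c, p c ≤ p 0 := fun c => hanti (Fin.zero_le c)
  have hp0 : p 0 ≠ 0 := by omega
  refine ⟨⟨⟨τ.Q11 p m hm t, τ.Q11Adj p m hm t, TauFunction.Q11_mul_Q11Adj p m hm t hτ,
    TauFunction.Q11Adj_mul_Q11 p m hm t hτ⟩, rfl⟩, ?_, fun a b => ⟨?_, ?_⟩, fun a b => ⟨?_, ?_⟩,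
    fun a b => ⟨?_, ?_⟩⟩
  · ext1 a b
    have h : (τ.laxTilde p m hm t a b +
        (τ.W12 p m hm t * τ.middle p m hm t * τ.W21 p m hm t) a b).IsDifferential := by
      -- The two copies of `restTerm` cancel.
      have := (TauFunction.isDifferential_laxTilde_add p m hm t hτ hp0 a b).add
        (τ.isDifferential_W12_mul_sub p m hm t hpos a b)
      rwa [add_add_sub_cancel] at this
    have h' := h.plus_eq
    rw [PDO.plus_add] at h'
    rw [TauFunction.W11]
    simp only [Matrix.sub_apply, Matrix.add_apply, Matrix.map_apply]
    rw [eq_sub_iff_add_eq, ← h']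
    abel
  · exact τ.isDifferential_W12 p m hm t a b
  · have := hle b
    rw [a.2]
    exact (τ.orderLE_W12 p m hm t a b).mono (by omega)
  · exact τ.isDifferential_W21 p m hm t a b
  · have := hle a
    rw [b.2]
    exact (τ.orderLE_W21 p m hm t a b).mono (by omega)
  · exact ((PDO.isDifferential_plus _).sub (τ.isDifferential_leadingTerm p m hm t a b)).add
      (PDO.isDifferential_plus _)
  · have h1 := (TauFunction.orderLE_laxTilde_sub p m hm t hτ hp0 a b).plus
    have h2 := (τ.orderLE_W12_mul p m hm t hle a b).plus
    -- The leading term is differential, so it splits off from the differential part, leaving an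
    -- operator of order at most `p_1 - 1`.
    have e : (τ.laxTilde p m hm t a b).plus
        = ((τ.laxTilde p m hm t - τ.leadingTerm p m hm t) a b).plus
          + τ.leadingTerm p m hm t a b := by
      conv_rhs => rw [← (τ.isDifferential_leadingTerm p m hm t a b).plus_eq]
      rw [← PDO.plus_add, Matrix.sub_apply, sub_add_cancel]
    rw [TauFunction.W11]
    simp only [Matrix.sub_apply, Matrix.add_apply, Matrix.map_apply]
    rw [e, add_sub_cancel_right]
    exact h1.add h2
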